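/- **Setting.** Fix $\delta\in(0,1/2)$, $\lambda_0>0$ and a nonnegative $\phi\in C_c^\infty(\mathbb R^2)$ whose support is contained in $[-\delta,\delta]^2$. On a probability space $(\Omega,\mathcal F,\mathbb P)$ let $l(i,j)$, $(i,j)\in\mathbb Z\times(\mathbb Z+\tfrac12)$, be i.i.d. exponential random variables with $\mathbb P\{l(i,j)>r\}=e^{-\lambda_0 r}$ for $r\ge 0$, and let $$f(x,s,\omega)=g(x,s,\omega)-\sum_{(i,j)\in\mathbb Z\times(\mathbb Z+1/2)} l(i,j)(\omega)\,\phi\big((x,s)-(i,j)\big),$$ where $g\ge 0$ is of class $C^1$ in $(x,s)$ and is such that almost surely $\lim_{L\to\infty}(2L)^{-2}\int_{[-L,L]^2}f(x,s,\omega)\,dx\,ds=0$. **Theorem 2.1.** There exist $F_0>0$, $C>0$, $K>0$ and $N_0\in\mathbb N$, depending only on $\delta$, $\lambda_0$ and $\phi$, such that for all $F>F_0$ and all integers $N\ge N_0$ there is an event $E\in\mathcal F$ with $$\mathbb P(E)\ \ge\ 1-C e^{-N/C}$$ such that for every $\omega\in E$, every classical solution $u$ of $$u_{xx}+f(x,u,\omega)+F=0\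 \text{ in }[-N+\delta,N-\delta],\qquad u(-N+\delta)=u(N-\delta)=0,$$ satisfies $u(x)\ge (K(N-1)-K|x|)_+$ for all $x\in[-N+\delta,N-\delta]$, where $a_+=\max(a,0)$. -/

import Mathlib

open MeasureTheory ProbabilityTheory Set Filter Topology

/-- The closed square `Q_δ(0,0) = [-δ, δ]²`. -/
def obstacleSquare (δ : ℝ) : Set (ℝ × ℝ) := Icc (-δ) δ ×ˢ Icc (-δ) δ

/-- An obstacle profile: a smooth nonnegative function supported in `[-δ, δ]²`. -/
structure IsObstacleProfile (δ : ℝ) (φ : ℝ × ℝ → ℝ) : Prop where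
  smooth : ContDiff ℝ ((⊤ : ℕ∞) : WithTop ℕ∞) φ
  nonneg : ∀ z, 0 ≤ φ z
  support_subset : Function.support φ ⊆ obstacleSquare δ

/-- The nodes of the lattice `ℤ × (ℤ + 1/2)`; the index `(i, j) ∈ ℤ × ℤ` stands for the
node `(i, j + 1/2)`. -/
noncomputable def latticeNode (p : ℤ × ℤ) : ℝ × ℝ := ((p.1 : ℝ), (p.2 : ℝ) + 1 / 2)

/-- The family `l` consists of independent exponential random variables of parameter `lam`. -/
structure IsIIDExponential {Ω : Type*} [MeasurableSpace Ω] (P : Measure Ω) (lam : ℝ)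
    (l : ℤ × ℤ → Ω → ℝ) : Prop where
  measurable : ∀ p, Measurable (l p)
  indep : iIndepFun l P
  tail : ∀ p, ∀ r : ℝ, 0 ≤ r → P {ω | r < l p ω} = ENNReal.ofReal (Real.exp (-lam * r))

/-- The field `f(x, s) = g(x, s) - ∑ l(i,j) φ((x, s) - b_{i,j})` for one realisation of the
obstacle strengths. At every `(x, s)` only finitely many terms of the sum are nonzero. -/
noncomputable def obstacleField (φ : ℝ × ℝ → ℝ) (g : ℝ × ℝ → ℝ) (l : ℤ × ℤ → ℝ)
    (x s : ℝ) : ℝ :=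
  g (x, s) - ∑' p : ℤ × ℤ, l p * φ ((x, s) - latticeNode p)

/-- Spatial mean zero: the averages of `f` over the squares `[-L, L]²` tend to zero. -/
def HasMeanZero (f : ℝ → ℝ → ℝ) : Prop :=
  Tendsto (fun L : ℝ => ((2 * L) ^ 2)⁻¹ * ∫ z in Icc (-L) L ×ˢ Icc (-L) L, f z.1 z.2)
    atTop (𝓝 0)

/-- A compensating field: the nonnegative `C¹` part `g` of the random field, which gives the
field mean zero almost surely. (A deterministic `g` is the case of a constant family.) -/
structure IsCompensator {Ω : Type*} [MeasurableSpace Ω] (P : Measure Ω) (φ : ℝ × ℝ → ℝ)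
    (l : ℤ × ℤ → Ω → ℝ) (g : Ω → ℝ × ℝ → ℝ) : Prop where
  contDiff : ∀ ω, ContDiff ℝ 1 (g ω)
  nonneg : ∀ ω z, 0 ≤ g ω z
  meanZero : ∀ᵐ ω ∂P, HasMeanZero (obstacleField φ (g ω) (fun p => l p ω))

/-- Classical solutions of the Dirichlet problem `u_xx + f(x, u) + F = 0` on `[a, b]` with
`u(a) = u(b) = 0`. For continuous `f` the second derivative of such a `u` extends
continuously to the endpoints, and the equation holds there as well. -/
structure IsDirichletSolution (f : ℝ → ℝ → ℝ) (F a b : ℝ) (u : ℝ → ℝ) : Prop where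
  continuousOn : ContinuousOn u (Icc a b)
  contDiffOn : ContDiffOn ℝ 2 u (Ioo a b)
  equation : ∀ x ∈ Ioo a b, deriv (deriv u) x + f x (u x) + F = 0
  left : u a = 0
  right : u b = 0

/-!
Suppose that a solution dips below the cone `K (N - δ - |x|)`. Green's formula with pole at the
place of the dip bounds the pushing force `F + g`, integrated against the distance to the boundary,
by `2 N` times the total force which the obstacles exert along the path, up to a multiple of `K N`.
Hence this total force is at least a multiple of `F N`, and it also controls the total curvature of
the path.

The path leaves a discrete trace: one integer height per column of nodes, whose second difference
is bounded by a curvature budget `Z`. In a column which the path crosses with a slope large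
compared to `Z` it spends a short time near each obstacle; otherwise it stays within a multiple of
`Z + 1` of its height, and the strongest obstacle there accounts for all the force. The strengths
charged in this way must pay for the energy of the trace, the weighted sum of its curvature
budgets, and for a multiple of `F N`.

For a fixed trace the charge is a sum of independent exponential variables with bounded weights of
total `O(N)`, so this has probability at most `exp (O(N) - γ (energy + F N))`. The heights of a
trace are determined by their second differences, so the sum of `exp (-γ energy)` over all traces
is at most a product over the columns, of size `exp (O(N))`, and the union bound succeeds once `F`
is large.
-/

/-! ### Green's formula on an interval -/

/-- `v` is twice differentiable on the whole line, with second derivative `q`. -/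
def HasSecondDeriv (v q : ℝ → ℝ) : Prop :=
  ∃ v' : ℝ → ℝ, (∀ x, HasDerivAt v (v' x) x) ∧ ∀ x, HasDerivAt v' (q x) x

theorem HasSecondDeriv.continuous {v q : ℝ → ℝ} (hv : HasSecondDeriv v q) : Continuous v :=
  let ⟨_, hv, _⟩ := hv
  continuous_iff_continuousAt.2 fun x => (hv x).continuousAt

theorem exists_hasSecondDeriv {q : ℝ → ℝ} (hq : Continuous q) : ∃ v, HasSecondDeriv v q := by
  have primitive : ∀ {p : ℝ → ℝ}, Continuous p → ∃ v : ℝ → ℝ, ∀ x, HasDerivAt v (p x) x :=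
    fun {p} hp => ⟨fun x => ∫ t in (0 : ℝ)..x, p t,
      fun x => (hp.integral_hasStrictDerivAt 0 x).hasDerivAt⟩
  obtain ⟨v', hv'⟩ := primitive hq
  obtain ⟨v, hv⟩ := primitive (continuous_iff_continuousAt.2 fun x => (hv' x).continuousAt)
  exact ⟨v, v', hv, hv'⟩

theorem exists_hasSecondDeriv_eqOn_Icc {u q : ℝ → ℝ} {a b : ℝ} (hab : a < b) (hq : Continuous q)
    (hu : ContinuousOn u (Icc a b)) (hu2 : ContDiffOn ℝ 2 u (Ioo a b))
    (h : ∀ x ∈ Ioo a b, deriv (deriv u) x = q x) :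
    ∃ v, HasSecondDeriv v q ∧ EqOn u v (Icc a b) := by
  obtain ⟨w, w', hw, hw'⟩ := exists_hasSecondDeriv hq
  have hderiv := (contDiffOn_succ_iff_deriv_of_isOpen (n := 1) isOpen_Ioo).1
    (by simpa only [one_add_one_eq_two] using hu2)
  obtain ⟨c, hc⟩ := isOpen_Ioo.exists_eq_add_of_deriv_eq isPreconnected_Ioo
    (hderiv.2.2.differentiableOn (by simp))
    (fun x _ => (hw' x).differentiableAt.differentiableWithinAt)
    fun x hx => (h x hx).trans (hw' x).deriv.symm
  have hwc : ∀ x, HasDerivAt (fun x => w x + c * x) (w' x + c) x := fun x =>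
    (hw x).add (hasDerivAt_const_mul c)
  obtain ⟨d, hd⟩ := isOpen_Ioo.exists_eq_add_of_deriv_eq isPreconnected_Ioo hderiv.1
    (fun x _ => (hwc x).differentiableAt.differentiableWithinAt)
    fun x hx => (hc hx).trans (hwc x).deriv.symm
  have hv : HasSecondDeriv (fun x => w x + c * x + d) q :=
    ⟨fun x => w' x + c, fun x => (hwc x).add_const d, fun x => (hw' x).add_const c⟩
  exact ⟨_, hv, hd.of_subset_closure hu hv.continuous.continuousOn Ioo_subset_Icc_self
    (closure_Ioo hab.ne).ge⟩

theorem HasSecondDeriv.integral_sub_mul {v v' q : ℝ → ℝ} (hv : ∀ x, HasDerivAt v (v' x) x)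
    (hv' : ∀ x, HasDerivAt v' (q x) x) (hq : Continuous q) (c s t : ℝ) :
    ∫ z in s..t, (z - c) * q z = ((t - c) * v' t - v t) - ((s - c) * v' s - v s) := by
  have hderiv : ∀ x, HasDerivAt (fun x => (x - c) * v' x - v x) ((x - c) * q x) x := fun x =>
    ((((hasDerivAt_id x).sub_const c).mul (hv' x)).sub (hv x)).congr_deriv (by simp)
  exact intervalIntegral.integral_eq_sub_of_hasDerivAt (fun x _ => hderiv x)
    (Continuous.intervalIntegrable (by fun_prop) _ _)

/-- The Green kernel of `-d²/dz²` on `[p, r]` with pole `m`, multiplied by `r - p`. -/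
def tent (p m r z : ℝ) : ℝ := min ((r - m) * (z - p)) ((m - p) * (r - z))

theorem continuous_tent (p m r : ℝ) : Continuous (tent p m r) := by
  unfold tent; fun_prop

theorem tent_nonneg {p m r z : ℝ} (hm : m ∈ Icc p r) (hz : z ∈ Icc p r) : 0 ≤ tent p m r z :=
  le_min (mul_nonneg (sub_nonneg.2 hm.2) (sub_nonneg.2 hz.1))
    (mul_nonneg (sub_nonneg.2 hm.1) (sub_nonneg.2 hz.2))

theorem tent_of_le {p m r z : ℝ} (hpr : p ≤ r) (hz : z ≤ m) :
    tent p m r z = (r - m) * (z - p) :=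
  min_eq_left (by nlinarith [mul_nonneg (sub_nonneg.2 hz) (sub_nonneg.2 hpr)])

theorem tent_of_ge {p m r z : ℝ} (hpr : p ≤ r) (hz : m ≤ z) :
    tent p m r z = (m - p) * (r - z) :=
  min_eq_right (by nlinarith [mul_nonneg (sub_nonneg.2 hz) (sub_nonneg.2 hpr)])

theorem tent_le {p m r : ℝ} (hm : m ∈ Icc p r) (z : ℝ) :
    tent p m r z ≤ (m - p) * (r - m) := by
  rcases le_total z m with hz | hz
  · rw [tent_of_le (hm.1.trans hm.2) hz, mul_comm]
    exact mul_le_mul_of_nonneg_right (by linarith) (sub_nonneg.2 hm.2)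
  · rw [tent_of_ge (hm.1.trans hm.2) hz]
    exact mul_le_mul_of_nonneg_left (by linarith) (sub_nonneg.2 hm.1)

theorem mul_hat_le_mul_tent {p m r z : ℝ} (hm : m ∈ Icc p r) (hz : z ∈ Icc p r) :
    (m - p) * (r - m) * min (z - p) (r - z) ≤ (r - p) * tent p m r z := by
  have hpm := sub_nonneg.2 hm.1
  have hmr := sub_nonneg.2 hm.2
  rw [tent, mul_min_of_nonneg _ _ (mul_nonneg hpm hmr), mul_min_of_nonneg _ _ (by linarith)]
  exact min_le_min (by linarith [mul_nonneg (mul_nonneg hmr hmr) (sub_nonneg.2 hz.1)])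
    (by linarith [mul_nonneg (mul_nonneg hpm hpm) (sub_nonneg.2 hz.2)])

theorem HasSecondDeriv.integral_tent_mul {v q : ℝ → ℝ} (hv : HasSecondDeriv v q)
    (hq : Continuous q) {p m r : ℝ} (hm : m ∈ Icc p r) :
    ∫ z in p..r, tent p m r z * q z = (r - m) * v p + (m - p) * v r - (r - p) * v m := by
  obtain ⟨v', hv, hv'⟩ := hv
  have hpr := hm.1.trans hm.2
  have left : ∫ z in p..m, tent p m r z * q z = (r - m) * ∫ z in p..m, (z - p) * q z := by
    rw [← intervalIntegral.integral_const_mul]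
    refine intervalIntegral.integral_congr fun z hz => ?_
    rw [uIcc_of_le hm.1] at hz
    simp only [tent_of_le hpr hz.2, mul_assoc]
  have right : ∫ z in m..r, tent p m r z * q z = -(m - p) * ∫ z in m..r, (z - r) * q z := by
    rw [← intervalIntegral.integral_const_mul]
    refine intervalIntegral.integral_congr fun z hz => ?_
    rw [uIcc_of_le hm.2] at hz
    simp only [tent_of_ge hpr hz.1]
    ring
  have hint : ∀ s t, IntervalIntegrable (fun z => tent p m r z * q z) volume s t := fun s t =>
    ((continuous_tent p m r).mul hq).intervalIntegrable s t
  rw [← intervalIntegral.integral_add_adjacent_intervals (hint p m) (hint m r), left, right,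
    integral_sub_mul hv hv' hq, integral_sub_mul hv hv' hq]
  ring

/-- The mass of `Q` weighted by the unit-slope hat over `[p, r]`: the budget of curvature that
`v'' = q` with `|q| ≤ Q` can spend in that window. -/
noncomputable def hatMass (Q : ℝ → ℝ) (p r : ℝ) : ℝ := ∫ z in p..r, min (z - p) (r - z) * Q z

theorem hat_nonneg {p r z : ℝ} (hz : z ∈ Icc p r) : 0 ≤ min (z - p) (r - z) :=
  le_min (sub_nonneg.2 hz.1) (sub_nonneg.2 hz.2)

theorem hatMass_nonneg {Q : ℝ → ℝ} (hQ : ∀ z, 0 ≤ Q z) {p r : ℝ} (hpr : p ≤ r) :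
    0 ≤ hatMass Q p r :=
  intervalIntegral.integral_nonneg hpr fun z hz => mul_nonneg (hat_nonneg hz) (hQ z)

theorem abs_integral_mul_le_hatMass {k q Q : ℝ → ℝ} {p r s t D : ℝ} (hD : 0 ≤ D) (hps : p ≤ s)
    (hst : s ≤ t) (htr : t ≤ r) (hk : Continuous k) (hq : Continuous q) (hQ : Continuous Q)
    (hqQ : ∀ z, |q z| ≤ Q z) (hk0 : ∀ z ∈ Icc s t, 0 ≤ k z)
    (hkD : ∀ z ∈ Icc s t, k z ≤ D * min (z - p) (r - z)) :
    |∫ z in s..t, k z * q z| ≤ D * hatMass Q p r := by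
  have hint : Continuous fun z => D * (min (z - p) (r - z) * Q z) := by fun_prop
  calc |∫ z in s..t, k z * q z| ≤ ∫ z in s..t, |k z * q z| :=
        intervalIntegral.abs_integral_le_integral_abs hst
    _ ≤ ∫ z in s..t, D * (min (z - p) (r - z) * Q z) := by
        refine intervalIntegral.integral_mono_on hst ((hk.mul hq).abs.intervalIntegrable _ _)
          (hint.intervalIntegrable _ _) fun z hz => ?_
        rw [abs_mul, abs_of_nonneg (hk0 z hz), ← mul_assoc]
        exact mul_le_mul (hkD z hz) (hqQ z) (abs_nonneg _) ((hk0 z hz).trans (hkD z hz))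
    _ ≤ ∫ z in p..r, D * (min (z - p) (r - z) * Q z) := by
        refine intervalIntegral.integral_mono_interval hps hst htr ?_ (hint.intervalIntegrable _ _)
        filter_upwards [ae_restrict_mem measurableSet_Ioc] with z hz
        exact mul_nonneg hD (mul_nonneg (hat_nonneg ⟨hz.1.le, hz.2⟩) ((abs_nonneg _).trans (hqQ z)))
    _ = D * hatMass Q p r := intervalIntegral.integral_const_mul _ _

theorem HasSecondDeriv.integral_hat_mul {v q : ℝ → ℝ} (hv : HasSecondDeriv v q)
    (hq : Continuous q) {m η : ℝ} (hη : 0 < η) :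
    hatMass q (m - η) (m + η) = v (m + η) - 2 * v m + v (m - η) := by
  have green := hv.integral_tent_mul hq (p := m - η) (m := m) (r := m + η)
    ⟨by linarith, by linarith⟩
  have htent : ∀ z, tent (m - η) m (m + η) z = η * min (z - (m - η)) (m + η - z) := fun z => by
    rw [tent, mul_min_of_nonneg _ _ hη.le]
    congr 1 <;> ring
  simp only [htent, mul_assoc, intervalIntegral.integral_const_mul] at green
  refine mul_left_cancel₀ hη.ne' (green.trans ?_)
  ring

theorem HasSecondDeriv.abs_second_difference_le {v q Q : ℝ → ℝ} (hv : HasSecondDeriv v q)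
    (hq : Continuous q) (hQ : Continuous Q) (hqQ : ∀ z, |q z| ≤ Q z) {m η : ℝ} (hη : 0 < η) :
    |v (m + η) - 2 * v m + v (m - η)| ≤ hatMass Q (m - η) (m + η) := by
  rw [← hv.integral_hat_mul hq hη]
  simpa only [one_mul, hatMass] using abs_integral_mul_le_hatMass zero_le_one le_rfl
    (by linarith) le_rfl (by fun_prop) hq hQ hqQ (fun z hz => hat_nonneg hz)
    fun z _ => (one_mul _).ge

theorem HasSecondDeriv.abs_secant_sub_le {v q Q : ℝ → ℝ} (hv : HasSecondDeriv v q)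
    (hq : Continuous q) (hQ : Continuous Q) (hqQ : ∀ z, |q z| ≤ Q z) {p r c y y' : ℝ}
    (hc : 0 < c) (hy : p + c ≤ y) (hyy : y ≤ y') (hy' : y' ≤ r - c) :
    |(v r - v p) / (r - p) * (y' - y) - (v y' - v y)| ≤ 2 / c * hatMass Q p r * (y' - y) := by
  have hpr : 0 < r - p := by linarith
  have hD : 0 ≤ (y' - y) * ((r - p) / c) := mul_nonneg (by linarith) (by positivity)
  have hscale : ∀ {x}, 0 ≤ x → x ≤ (r - p) / c * x := fun hx =>
    le_mul_of_one_le_left hx ((one_le_div hc).2 (by linarith))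
  have hlarge : ∀ {x w}, w ≤ r - p → c ≤ x → w ≤ (r - p) / c * x := fun hw hx =>
    hw.trans (by rw [div_mul_eq_mul_div, le_div_iff₀ hc]; gcongr)
  have left : |∫ z in p..y', tent p y y' z * q z| ≤ (y' - y) * ((r - p) / c) * hatMass Q p r := by
    refine abs_integral_mul_le_hatMass hD le_rfl (by linarith) (by linarith)
      (continuous_tent _ _ _) hq hQ hqQ (fun z hz => tent_nonneg ⟨by linarith, hyy⟩ hz)
      fun z hz => (min_le_left _ _).trans ?_
    rw [mul_assoc, mul_min_of_nonneg _ _ (by positivity)]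
    exact mul_le_mul_of_nonneg_left (le_min (hscale (by linarith [hz.1]))
      (hlarge (by linarith [hz.2]) (by linarith [hz.2]))) (by linarith)
  have right : |∫ z in y..r, tent y y' r z * q z| ≤ (y' - y) * ((r - p) / c) * hatMass Q p r := by
    refine abs_integral_mul_le_hatMass hD (by linarith) (by linarith) le_rfl
      (continuous_tent _ _ _) hq hQ hqQ (fun z hz => tent_nonneg ⟨hyy, by linarith⟩ hz)
      fun z hz => (min_le_right _ _).trans ?_
    rw [mul_assoc, mul_min_of_nonneg _ _ (by positivity)]
    exact mul_le_mul_of_nonneg_left (le_min (hlarge (by linarith [hz.1]) (by linarith [hz.1]))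
      (hscale (by linarith [hz.2]))) (by linarith)
  rw [hv.integral_tent_mul hq ⟨by linarith, hyy⟩] at left
  rw [hv.integral_tent_mul hq ⟨hyy, by linarith⟩] at right
  have hsplit : (r - p) * ((v r - v p) / (r - p) * (y' - y) - (v y' - v y)) =
      ((r - y') * v y + (y' - y) * v r - (r - y) * v y') -
        ((y' - y) * v p + (y - p) * v y' - (y' - p) * v y) := by
    field_simp
    ring
  refine le_of_mul_le_mul_left ?_ hpr
  calc (r - p) * |(v r - v p) / (r - p) * (y' - y) - (v y' - v y)|
      = |(r - p) * ((v r - v p) / (r - p) * (y' - y) - (v y' - v y))| := by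
        rw [abs_mul, abs_of_pos hpr]
    _ ≤ (y' - y) * ((r - p) / c) * hatMass Q p r + (y' - y) * ((r - p) / c) * hatMass Q p r := by
        rw [hsplit]
        exact (abs_sub _ _).trans (add_le_add right left)
    _ = (r - p) * (2 / c * hatMass Q p r * (y' - y)) := by ring

theorem HasSecondDeriv.hatMass_le_of_lt {v P R : ℝ → ℝ} {a K x₀ : ℝ}
    (hv : HasSecondDeriv v fun x => R x - P x) (hP : Continuous P) (hR : Continuous R)
    (hP0 : ∀ z, 0 ≤ P z) (hR0 : ∀ z, 0 ≤ R z) (hleft : v (-a) = 0) (hright : v a = 0)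
    (hK : 0 ≤ K) (hx₀ : |x₀| < a) (hdip : v x₀ < K * (a - |x₀|)) :
    hatMass P (-a) a ≤ 2 * a * ((∫ z in (-a)..a, R z) + 2 * K) := by
  have ha : 0 < a := (abs_nonneg _).trans_lt hx₀
  obtain ⟨hx₁, hx₂⟩ := abs_lt.1 hx₀
  have hmem : x₀ ∈ Icc (-a) a := ⟨hx₁.le, hx₂.le⟩
  set B := (x₀ - -a) * (a - x₀)
  have hB0 : 0 < B := mul_pos (by linarith) (by linarith)
  have hBa : a * (a - |x₀|) ≤ B := by
    calc a * (a - |x₀|) ≤ (a + |x₀|) * (a - |x₀|) := by gcongr; linarith [abs_nonneg x₀]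
      _ = B := by linarith [abs_mul_abs_self x₀]
  have green := hv.integral_tent_mul (hR.sub hP) hmem
  have htR : Continuous fun z => tent (-a) x₀ a z * R z := (continuous_tent _ _ _).mul hR
  have htP : Continuous fun z => tent (-a) x₀ a z * P z := (continuous_tent _ _ _).mul hP
  simp only [mul_sub] at green
  rw [intervalIntegral.integral_sub (htR.intervalIntegrable _ _) (htP.intervalIntegrable _ _),
    hleft, hright] at green
  have massR : ∫ z in (-a)..a, tent (-a) x₀ a z * R z ≤ B * ∫ z in (-a)..a, R z := by
    rw [← intervalIntegral.integral_const_mul]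
    exact intervalIntegral.integral_mono_on (by linarith) (htR.intervalIntegrable _ _)
      ((continuous_const.mul hR).intervalIntegrable _ _) fun z _ =>
      mul_le_mul_of_nonneg_right (tent_le hmem z) (hR0 z)
  have massP : B * hatMass P (-a) a ≤ (a - -a) * ∫ z in (-a)..a, tent (-a) x₀ a z * P z := by
    rw [hatMass, ← intervalIntegral.integral_const_mul, ← intervalIntegral.integral_const_mul]
    refine intervalIntegral.integral_mono_on (by linarith)
      (Continuous.intervalIntegrable (by fun_prop) _ _)
      ((continuous_const.mul htP).intervalIntegrable _ _) fun z hz => ?_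
    rw [← mul_assoc, ← mul_assoc]
    exact mul_le_mul_of_nonneg_right (mul_hat_le_mul_tent hmem hz) (hP0 z)
  have dip : ∫ z in (-a)..a, tent (-a) x₀ a z * P z ≤ B * ((∫ z in (-a)..a, R z) + 2 * K) := by
    linarith [mul_le_mul_of_nonneg_left hBa hK, mul_lt_mul_of_pos_left hdip ha]
  refine le_of_mul_le_mul_left ?_ hB0
  linarith [mul_le_mul_of_nonneg_left dip ha.le]

/-! ### Mass balance over the columns -/

/-- The abscissae `i` of the columns of nodes that meet `(-N, N)`. -/
noncomputable def columns (N : ℕ) : Finset ℤ := Finset.Ioo (-(N : ℤ)) N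

theorem mem_columns {N : ℕ} {i : ℤ} : i ∈ columns N ↔ |i| + 1 ≤ N := by
  rw [columns, Finset.mem_Ioo, ← abs_lt, Int.add_one_le_iff]

theorem card_columns_le (N : ℕ) : (columns N).card ≤ 2 * N := by
  rw [columns, Int.card_Ioo]
  omega

theorem columns_succ (N : ℕ) : columns (N + 1) = Finset.Icc (-(N : ℤ)) N := by
  ext i
  simp only [columns, Finset.mem_Ioo, Finset.mem_Icc]
  omega

theorem sum_columns_succ (f : ℤ → ℝ) (N : ℕ) :
    ∑ i ∈ columns (N + 1 + 1), f i = f (N + 1) + f (-(N + 1)) + ∑ i ∈ columns (N + 1), f i := by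
  rw [columns_succ, columns_succ]
  exact_mod_cast Finset.sum_Icc_succ_eq_add_endpoints f (N := N)

theorem sum_second_difference (W : ℤ → ℝ) (N : ℕ) :
    ∑ i ∈ columns (N + 1), (W (i + 1) - 2 * W i + W (i - 1)) =
      W (N + 1) - W N + (W (-N - 1) - W (-N)) := by
  induction N with
  | zero =>
    simp only [zero_add, columns_succ, CharP.cast_eq_zero, neg_zero, Finset.Icc_self,
      Finset.sum_singleton, zero_sub]
    ring
  | succ N ih =>
    rw [sum_columns_succ, ih]
    push_cast
    rw [add_sub_cancel_right, show -((N : ℤ) + 1) + 1 = -N by ring,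
      show -((N : ℤ) + 1) = -N - 1 by ring]
    ring

theorem sum_columns_mul_second_difference (W : ℤ → ℝ) (N : ℕ) :
    ∑ i ∈ columns N, (N - |(i : ℝ)|) * (W (i + 1) - 2 * W i + W (i - 1)) =
      W N - 2 * W 0 + W (-N) := by
  induction N with
  | zero =>
    simp only [columns, CharP.cast_eq_zero, neg_zero, lt_self_iff_false, not_false_eq_true,
      Finset.Ioo_eq_empty, Finset.sum_empty]
    ring
  | succ N ih =>
    have hsubset : columns N ⊆ columns (N + 1) := fun i hi => by
      rw [mem_columns] at hi ⊢
      push_cast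
      omega
    have hboundary : ∀ i ∈ columns (N + 1), i ∉ columns N →
        (N - |(i : ℝ)|) * (W (i + 1) - 2 * W i + W (i - 1)) = 0 := fun i hi hi' => by
      rw [mem_columns] at hi hi'
      have : |i| = N := by push_cast at hi; omega
      rw [← Int.cast_abs, this, Int.cast_natCast, sub_self, zero_mul]
    rw [Finset.sum_subset hsubset hboundary] at ih
    calc ∑ i ∈ columns (N + 1), (((N + 1 : ℕ) : ℝ) - |(i : ℝ)|) * (W (i + 1) - 2 * W i + W (i - 1))
        = ∑ i ∈ columns (N + 1), (N - |(i : ℝ)|) * (W (i + 1) - 2 * W i + W (i - 1)) +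
            ∑ i ∈ columns (N + 1), (W (i + 1) - 2 * W i + W (i - 1)) := by
          rw [← Finset.sum_add_distrib]
          push_cast
          exact Finset.sum_congr rfl fun i _ => by ring
      _ = W ((N + 1 : ℕ) : ℤ) - 2 * W 0 + W (-((N + 1 : ℕ) : ℤ)) := by
          rw [ih, sum_second_difference]
          push_cast
          rw [neg_add']
          ring

theorem sum_columns_mul_hatMass {Q : ℝ → ℝ} (hQ : Continuous Q) {η : ℝ} (hη : 0 < η) (N : ℕ) :
    ∑ i ∈ columns N, (N - |(i : ℝ)|) * hatMass Q (i * η - η) (i * η + η) =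
      hatMass Q (-(N * η)) (N * η) := by
  obtain ⟨V, hV⟩ := exists_hasSecondDeriv hQ
  rcases N.eq_zero_or_pos with rfl | hN
  · simp [columns, hatMass]
  have green := sum_columns_mul_second_difference (fun i => V (i * η)) N
  have whole := hV.integral_hat_mul hQ (m := 0) (η := N * η) (by positivity)
  rw [zero_sub, zero_add] at whole
  rw [whole]
  simp only [Int.cast_add, Int.cast_sub, Int.cast_one, add_one_mul, sub_one_mul,
    ← hV.integral_hat_mul hQ hη, Int.cast_zero, zero_mul, Int.cast_neg, Int.cast_natCast,
    neg_mul] at green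
  exact green

theorem hatMass_const (F : ℝ) {a : ℝ} (ha : 0 < a) : hatMass (fun _ => F) (-a) a = F * a ^ 2 := by
  have hv : HasSecondDeriv (fun z => F * z ^ 2 / 2) fun _ => F :=
    ⟨fun z => F * z, fun x => (((hasDerivAt_pow 2 x).const_mul F).div_const 2).congr_deriv
      (by push_cast; ring), fun _ => hasDerivAt_const_mul F⟩
  have green := hv.integral_hat_mul continuous_const (m := 0) ha
  rw [zero_sub, zero_add] at green
  rw [green]
  ring

theorem hatMass_le {Q : ℝ → ℝ} (hQ : Continuous Q) (hQ0 : ∀ z, 0 ≤ Q z) {a : ℝ} (ha : 0 ≤ a) :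
    hatMass Q (-a) a ≤ a * ∫ z in (-a)..a, Q z := by
  rw [hatMass, ← intervalIntegral.integral_const_mul]
  refine intervalIntegral.integral_mono_on (by linarith)
    (Continuous.intervalIntegrable (by fun_prop) _ _)
    ((continuous_const.mul hQ).intervalIntegrable _ _) fun z _ =>
    mul_le_mul_of_nonneg_right ?_ (hQ0 z)
  rcases le_total z 0 with h | h
  · exact (min_le_left _ _).trans (by linarith)
  · exact (min_le_right _ _).trans (by linarith)

theorem hatMass_add {P Q : ℝ → ℝ} (hP : Continuous P) (hQ : Continuous Q) (p r : ℝ) :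
    hatMass (fun z => P z + Q z) p r = hatMass P p r + hatMass Q p r := by
  simp only [hatMass, mul_add]
  exact intervalIntegral.integral_add (Continuous.intervalIntegrable (by fun_prop) _ _)
    (Continuous.intervalIntegrable (by fun_prop) _ _)

theorem hatMass_mono {P Q : ℝ → ℝ} (hP : Continuous P) (hQ : Continuous Q)
    (hPQ : ∀ z, P z ≤ Q z) {p r : ℝ} (hpr : p ≤ r) : hatMass P p r ≤ hatMass Q p r :=
  intervalIntegral.integral_mono_on hpr (Continuous.intervalIntegrable (by fun_prop) _ _)
    (Continuous.intervalIntegrable (by fun_prop) _ _)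
    fun z hz => mul_le_mul_of_nonneg_left (hPQ z) (hat_nonneg hz)

/-! ### Obstacles near a path -/

/-- The abscissae within `δ` of `t` at which the graph of `v` is within `δ` of the height
`j + 1/2`: where the obstacle at the node `(t, j + 1/2)` can act on `v`. -/
def visitSet (δ t : ℝ) (v : ℝ → ℝ) (j : ℤ) : Set ℝ :=
  {y | y ∈ Icc (t - δ) (t + δ) ∧ |v y - (j + 1 / 2)| ≤ δ}

theorem measurableSet_visitSet {δ t : ℝ} {v : ℝ → ℝ} (hv : Continuous v) (j : ℤ) :
    MeasurableSet (visitSet δ t v j) :=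
  (isClosed_Icc.inter (isClosed_le (hv.sub continuous_const).abs continuous_const)).measurableSet

theorem volume_visitSet_ne_top {δ t : ℝ} {v : ℝ → ℝ} {j : ℤ} :
    volume (visitSet δ t v j) ≠ ⊤ :=
  ((measure_mono fun _ h => h.1).trans_lt measure_Icc_lt_top).ne

theorem disjoint_visitSet {δ t : ℝ} {v : ℝ → ℝ} (hδ : δ < 1 / 2) {i j : ℤ} (hij : i ≠ j) :
    Disjoint (visitSet δ t v i) (visitSet δ t v j) := by
  refine Set.disjoint_left.2 fun y hi hj => hij ?_
  obtain ⟨hi₁, hi₂⟩ := abs_le.1 hi.2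
  obtain ⟨hj₁, hj₂⟩ := abs_le.1 hj.2
  have hlt : (i : ℝ) < j + 1 := by linarith
  have hgt : (j : ℝ) < i + 1 := by linarith
  norm_cast at hlt hgt
  omega

theorem sum_volume_visitSet_le {δ t : ℝ} {v : ℝ → ℝ} (hv : Continuous v) (hδ0 : 0 ≤ δ)
    (hδ : δ < 1 / 2) (s : Finset ℤ) : ∑ j ∈ s, volume.real (visitSet δ t v j) ≤ 1 := by
  rw [← measureReal_biUnion_finset (fun i _ j _ hij => disjoint_visitSet hδ hij)
    (fun j _ => measurableSet_visitSet hv j) (fun j _ => volume_visitSet_ne_top)]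
  refine (measureReal_mono (s₂ := Icc (t - δ) (t + δ)) (iUnion₂_subset fun j _ _ h => h.1)
    measure_Icc_lt_top.ne).trans ?_
  rw [Real.volume_real_Icc_of_le (by linarith)]
  linarith

theorem volume_visitSet_le_of_steep {δ t σ : ℝ} {v : ℝ → ℝ} (hσ : 0 < σ) (hδ : δ ≤ 1 / 2)
    (hsteep : ∀ y ∈ Icc (t - δ) (t + δ), ∀ y' ∈ Icc (t - δ) (t + δ), y ≤ y' →
      σ * (y' - y) ≤ |v y' - v y|) (j : ℤ) :
    volume.real (visitSet δ t v j) ≤ 1 / σ := by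
  have hdist : ∀ y ∈ visitSet δ t v j, ∀ y' ∈ visitSet δ t v j, y ≤ y' → y' - y ≤ 1 / σ := by
    intro y hy y' hy' hyy
    rw [le_div_iff₀ hσ, mul_comm]
    refine (hsteep y hy.1 y' hy'.1 hyy).trans ?_
    have h := abs_le.1 hy.2
    have h' := abs_le.1 hy'.2
    exact abs_le.2 ⟨by linarith, by linarith⟩
  refine ENNReal.toReal_le_of_le_ofReal (by positivity)
    ((Real.volume_le_diam _).trans (Metric.ediam_le fun y hy y' hy' => ?_))
  rw [edist_dist, Real.dist_eq]
  refine ENNReal.ofReal_le_ofReal ?_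
  rcases le_total y y' with hyy | hyy
  · rw [abs_sub_comm, abs_of_nonneg (sub_nonneg.2 hyy)]
    exact hdist y hy y' hy' hyy
  · rw [abs_of_nonneg (sub_nonneg.2 hyy)]
    exact hdist y' hy' y hy hyy

section Profile

variable {δ : ℝ} {φ : ℝ × ℝ → ℝ}

/- Since `φ` is continuous its support is open, hence contained in the open square. -/
theorem eq_zero_of_support_subset_obstacleSquare (hφ : Continuous φ)
    (hsupp : Function.support φ ⊆ obstacleSquare δ) {z : ℝ × ℝ} (hz : δ ≤ |z.1| ∨ δ ≤ |z.2|) :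
    φ z = 0 := by
  by_contra hne
  have hopen : Function.support φ ⊆ interior (obstacleSquare δ) :=
    interior_maximal hsupp hφ.isOpen_support
  have hmem := hopen hne
  rw [obstacleSquare, interior_prod_eq, interior_Icc, mem_prod, mem_Ioo, mem_Ioo, ← abs_lt,
    ← abs_lt] at hmem
  exact hz.elim hmem.1.not_ge hmem.2.not_ge

theorem exists_forall_le_of_support_subset_obstacleSquare (hφ : Continuous φ)
    (hsupp : Function.support φ ⊆ obstacleSquare δ) : ∃ M : ℝ, 1 ≤ M ∧ ∀ z, φ z ≤ M := by
  obtain ⟨C, hC⟩ := (isCompact_Icc.prod isCompact_Icc :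
    IsCompact (obstacleSquare δ)).exists_bound_of_continuousOn hφ.continuousOn
  refine ⟨max C 1, le_max_right _ _, fun z => ?_⟩
  by_cases hz : φ z = 0
  · exact hz.trans_le (zero_le_one.trans (le_max_right _ _))
  · exact (le_abs_self _).trans ((hC z (hsupp hz)).trans (le_max_left _ _))

theorem eq_zero_of_notMem_visitSet (hφ : Continuous φ)
    (hsupp : Function.support φ ⊆ obstacleSquare δ) {w : ℝ → ℝ} {y : ℝ} {p : ℤ × ℤ}
    (hy : y ∉ visitSet δ p.1 w p.2) : φ ((y, w y) - latticeNode p) = 0 := by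
  refine eq_zero_of_support_subset_obstacleSquare hφ hsupp ?_
  by_contra! hz
  obtain ⟨h₁, h₂⟩ := abs_lt.1 hz.1
  simp only [latticeNode, Prod.fst_sub] at h₁ h₂
  exact hy ⟨⟨by linarith, by linarith⟩, hz.2.le⟩

theorem integral_profile_le (hφ : Continuous φ) (hsupp : Function.support φ ⊆ obstacleSquare δ)
    {M : ℝ} (hM0 : 0 ≤ M) (hM : ∀ z, φ z ≤ M) {w : ℝ → ℝ} (hw : Continuous w) {a : ℝ}
    (ha : 0 ≤ a) (p : ℤ × ℤ) :
    ∫ y in (-a)..a, φ ((y, w y) - latticeNode p) ≤ M * volume.real (visitSet δ p.1 w p.2) := by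
  have hmeas := measurableSet_visitSet (δ := δ) (t := p.1) hw p.2
  have hint : Integrable ((visitSet δ p.1 w p.2).indicator fun _ => M) :=
    (integrable_indicator_iff hmeas).2 (integrableOn_const volume_visitSet_ne_top)
  calc ∫ y in (-a)..a, φ ((y, w y) - latticeNode p)
      ≤ ∫ y in (-a)..a, (visitSet δ p.1 w p.2).indicator (fun _ => M) y := by
        refine intervalIntegral.integral_mono (by linarith)
          (Continuous.intervalIntegrable (by fun_prop) _ _) hint.intervalIntegrable fun y =>
          le_indicator_apply (fun _ => hM _) fun h =>
            (eq_zero_of_notMem_visitSet hφ hsupp h).le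
    _ ≤ ∫ y, (visitSet δ p.1 w p.2).indicator (fun _ => M) y := by
        rw [intervalIntegral.integral_of_le (by linarith)]
        exact setIntegral_le_integral hint
          (Eventually.of_forall fun y => indicator_nonneg (fun _ _ => hM0) y)
    _ = M * volume.real (visitSet δ p.1 w p.2) := by
        rw [integral_indicator hmeas, setIntegral_const, smul_eq_mul, mul_comm]

theorem integral_sum_profile_le (hφ : Continuous φ)
    (hsupp : Function.support φ ⊆ obstacleSquare δ) {M : ℝ} (hM0 : 0 ≤ M) (hM : ∀ z, φ z ≤ M)
    {w : ℝ → ℝ} (hw : Continuous w) {a : ℝ} (ha : 0 ≤ a) {l : ℤ × ℤ → ℝ} (hl : ∀ p, 0 ≤ l p)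
    (I s : Finset ℤ) :
    ∫ y in (-a)..a, ∑ p ∈ I ×ˢ s, l p * φ ((y, w y) - latticeNode p) ≤
      M * ∑ i ∈ I, ∑ j ∈ s, l (i, j) * volume.real (visitSet δ i w j) := by
  rw [intervalIntegral.integral_finsetSum fun p _ =>
    Continuous.intervalIntegrable (by fun_prop) _ _, ← Finset.sum_product', Finset.mul_sum]
  refine Finset.sum_le_sum fun p _ => ?_
  rw [intervalIntegral.integral_const_mul, mul_left_comm]
  exact mul_le_mul_of_nonneg_left (integral_profile_le hφ hsupp hM0 hM hw ha p) (hl p)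

end Profile

/-- The heights of the obstacles which a path with floor height `h`, slope `σ` and curvature
budget `Z` is charged for in one column. A path with `A * (Z + 1) ≤ σ` crosses the column
steeply, and is charged for all the obstacles it may cross; otherwise it stays near height `h` and
is charged for the single obstacle `h + m`, the strongest one within its reach. -/
noncomputable def chargedNodes (A Z σ : ℕ) (h m : ℤ) : Finset ℤ :=
  if A * (Z + 1) ≤ σ then Finset.Icc (h - (2 * σ + 2)) (h + (2 * σ + 2)) else {h + m}

/-- The weight with which each obstacle of `chargedNodes` is charged: a bound for the time that a
path spends near it. -/
noncomputable def chargeWeight (A Z σ : ℕ) : ℝ := if A * (Z + 1) ≤ σ then 4 / σ else 1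

theorem chargeWeight_nonneg (A Z σ : ℕ) : 0 ≤ chargeWeight A Z σ := by
  unfold chargeWeight
  split_ifs <;> positivity

theorem chargeWeight_le {A : ℕ} (hA : 1 ≤ A) (Z σ : ℕ) : chargeWeight A Z σ ≤ 4 := by
  unfold chargeWeight
  split_ifs with hsteep
  · exact div_le_self (by norm_num) (by exact_mod_cast (Nat.mul_pos hA Z.succ_pos).trans_le hsteep)
  · norm_num

theorem sum_chargeWeight_le {A : ℕ} (hA : 1 ≤ A) (Z σ : ℕ) (h m : ℤ) :
    ∑ _j ∈ chargedNodes A Z σ h m, chargeWeight A Z σ ≤ 36 := by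
  unfold chargeWeight chargedNodes
  split_ifs with hsteep
  · have hσ : (1 : ℝ) ≤ σ := by exact_mod_cast (Nat.mul_pos hA Z.succ_pos).trans_le hsteep
    have hcard : (h + (2 * (σ : ℤ) + 2) + 1 - (h - (2 * σ + 2))).toNat = 4 * σ + 5 := by omega
    rw [Finset.sum_const, Int.card_Icc, nsmul_eq_mul, hcard, ← mul_div_assoc,
      div_le_iff₀ (by linarith)]
    push_cast
    linarith
  · simp

section Column

variable {δ t x : ℝ} {v : ℝ → ℝ} {l : ℤ → ℝ}

theorem mem_Icc_of_volume_visitSet_ne_zero {r : ℝ}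
    (hrange : ∀ y ∈ Icc (t - δ) (t + δ), |v y - v x| ≤ r) (hδ : δ ≤ 1 / 2) {B : ℤ}
    (hB : r + 2 ≤ B) {j : ℤ} (hj : volume.real (visitSet δ t v j) ≠ 0) :
    j ∈ Finset.Icc (⌊v x⌋ - B) (⌊v x⌋ + B) := by
  obtain ⟨y, hy, hyj⟩ : (visitSet δ t v j).Nonempty := by
    refine nonempty_iff_ne_empty.2 fun hempty => hj ?_
    rw [hempty, measureReal_empty]
  have hfloor := Int.floor_le (v x)
  have hfloor' := Int.lt_floor_add_one (v x)
  obtain ⟨h₁, h₂⟩ := abs_le.1 (hrange y hy)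
  obtain ⟨h₃, h₄⟩ := abs_le.1 hyj
  have hlower : ((⌊v x⌋ - B : ℤ) : ℝ) ≤ j := by push_cast; linarith
  have hupper : (j : ℝ) ≤ ((⌊v x⌋ + B : ℤ) : ℝ) := by push_cast; linarith
  exact Finset.mem_Icc.2 ⟨by exact_mod_cast hlower, by exact_mod_cast hupper⟩

theorem sum_mul_volume_visitSet_le_of_steep {r σ : ℝ} (hσ : 0 < σ)
    (hsteep : ∀ y ∈ Icc (t - δ) (t + δ), ∀ y' ∈ Icc (t - δ) (t + δ), y ≤ y' →
      σ * (y' - y) ≤ |v y' - v y|)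
    (hrange : ∀ y ∈ Icc (t - δ) (t + δ), |v y - v x| ≤ r) (hδ : δ ≤ 1 / 2) {B : ℤ}
    (hB : r + 2 ≤ B) (hl : ∀ j, 0 ≤ l j) (s : Finset ℤ) :
    ∑ j ∈ s, l j * volume.real (visitSet δ t v j) ≤
      ∑ j ∈ Finset.Icc (⌊v x⌋ - B) (⌊v x⌋ + B), 1 / σ * l j := by
  calc ∑ j ∈ s, l j * volume.real (visitSet δ t v j)
      = ∑ j ∈ s with volume.real (visitSet δ t v j) ≠ 0,
          l j * volume.real (visitSet δ t v j) :=
        (Finset.sum_filter_of_ne fun j _ => right_ne_zero_of_mul).symm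
    _ ≤ ∑ j ∈ s with volume.real (visitSet δ t v j) ≠ 0, 1 / σ * l j :=
        Finset.sum_le_sum fun j _ => by
          rw [mul_comm]
          exact mul_le_mul_of_nonneg_right (volume_visitSet_le_of_steep hσ hδ hsteep j) (hl j)
    _ ≤ ∑ j ∈ Finset.Icc (⌊v x⌋ - B) (⌊v x⌋ + B), 1 / σ * l j :=
        Finset.sum_le_sum_of_subset_of_nonneg
          (fun j hj => mem_Icc_of_volume_visitSet_ne_zero hrange hδ hB (Finset.mem_filter.1 hj).2)
          fun j _ _ => mul_nonneg (by positivity) (hl j)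

theorem exists_sum_mul_volume_visitSet_le (hv : Continuous v) {r : ℝ} (hr : 0 ≤ r)
    (hrange : ∀ y ∈ Icc (t - δ) (t + δ), |v y - v x| ≤ r) (hδ0 : 0 ≤ δ) (hδ : δ < 1 / 2) {B : ℤ}
    (hB : r + 2 ≤ B) (hl : ∀ j, 0 ≤ l j) (s : Finset ℤ) :
    ∃ m : ℤ, |m| ≤ B ∧ ∑ j ∈ s, l j * volume.real (visitSet δ t v j) ≤ l (⌊v x⌋ + m) := by
  have hB0 : 0 ≤ B := by exact_mod_cast (by linarith : (0 : ℝ) ≤ B)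
  obtain ⟨k, hk, hmax⟩ := Finset.exists_max_image (Finset.Icc (⌊v x⌋ - B) (⌊v x⌋ + B)) l
    ⟨⌊v x⌋, Finset.mem_Icc.2 ⟨by linarith, by linarith⟩⟩
  rw [Finset.mem_Icc] at hk
  refine ⟨k - ⌊v x⌋, abs_le.2 ⟨by linarith, by linarith⟩, ?_⟩
  rw [add_sub_cancel]
  calc ∑ j ∈ s, l j * volume.real (visitSet δ t v j)
      ≤ ∑ j ∈ s, l k * volume.real (visitSet δ t v j) := by
        refine Finset.sum_le_sum fun j _ => ?_
        by_cases hj : volume.real (visitSet δ t v j) = 0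
        · rw [hj, mul_zero, mul_zero]
        · exact mul_le_mul_of_nonneg_right
            (hmax j (mem_Icc_of_volume_visitSet_ne_zero hrange hδ.le hB hj)) measureReal_nonneg
    _ = l k * ∑ j ∈ s, volume.real (visitSet δ t v j) := (Finset.mul_sum _ _ _).symm
    _ ≤ l k := mul_le_of_le_one_right (hl k) (sum_volume_visitSet_le hv hδ0 hδ s)

theorem abs_sub_abs_le_of_secant {S d y y' : ℝ} (hyy : y ≤ y')
    (hsecant : |S * (y' - y) - (v y' - v y)| ≤ d * (y' - y)) :
    (|S| - d) * (y' - y) ≤ |v y' - v y| ∧ |v y' - v y| ≤ (|S| + d) * (y' - y) := by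
  have hS : |S * (y' - y)| = |S| * (y' - y) := by rw [abs_mul, abs_of_nonneg (sub_nonneg.2 hyy)]
  have h₁ := abs_sub_abs_le_abs_sub (S * (y' - y)) (v y' - v y)
  have h₂ := abs_sub_abs_le_abs_sub (v y' - v y) (S * (y' - y))
  rw [abs_sub_comm (v y' - v y) (S * (y' - y))] at h₂
  constructor <;> linarith

theorem exists_mark_sum_mul_volume_visitSet_le (hv : Continuous v) (hδ0 : 0 ≤ δ) (hδ : δ < 1 / 2)
    (hx : x ∈ Icc (t - δ) (t + δ)) {S C : ℝ} {A Z σ : ℕ} (hC : 0 ≤ C)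
    (hsecant : ∀ y ∈ Icc (t - δ) (t + δ), ∀ y' ∈ Icc (t - δ) (t + δ), y ≤ y' →
      |S * (y' - y) - (v y' - v y)| ≤ C * Z * (y' - y))
    (hlower : (σ - 1) / 2 ≤ |S|) (hupper : |S| ≤ σ + 1) (hA : 2 * (1 + 2 * C) ≤ A)
    (hl : ∀ j, 0 ≤ l j) (s : Finset ℤ) :
    ∃ m : ℤ, |m| ≤ (2 * A + 2) * (Z + 1) ∧
      ∑ j ∈ s, l j * volume.real (visitSet δ t v j) ≤
        ∑ j ∈ chargedNodes A Z σ ⌊v x⌋ m, chargeWeight A Z σ * l j := by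
  have hCZ : 0 ≤ C * Z := by positivity
  have hrange : ∀ y ∈ Icc (t - δ) (t + δ), |v y - v x| ≤ σ + 1 + C * Z := by
    intro y hy
    have : 0 ≤ |S| + C * Z := by positivity
    rcases le_total x y with hxy | hxy
    · have := (abs_sub_abs_le_of_secant hxy (hsecant x hx y hy hxy)).2
      nlinarith [hx.1, hy.2]
    · have := (abs_sub_abs_le_of_secant hxy (hsecant y hy x hx hxy)).2
      rw [abs_sub_comm]
      nlinarith [hx.2, hy.1]
  by_cases hsteep : A * (Z + 1) ≤ σ
  · have hsteep' : (A : ℝ) * (Z + 1) ≤ σ := by exact_mod_cast hsteep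
    have hσ : 1 + 2 * (C * Z) ≤ σ / 2 := by nlinarith
    refine ⟨0, by rw [abs_zero]; positivity, ?_⟩
    simp only [chargedNodes, chargeWeight, hsteep, if_true]
    rw [← one_div_div]
    refine sum_mul_volume_visitSet_le_of_steep (by linarith) (fun y hy y' hy' hyy => ?_) hrange
      hδ.le (by push_cast; linarith) hl s
    refine le_trans ?_ (abs_sub_abs_le_of_secant hyy (hsecant y hy y' hy' hyy)).1
    exact mul_le_mul_of_nonneg_right (by linarith) (sub_nonneg.2 hyy)
  · have hflat : (σ : ℝ) ≤ A * (Z + 1) := by exact_mod_cast (not_le.1 hsteep).le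
    simp only [chargedNodes, chargeWeight, hsteep, if_false, Finset.sum_singleton, one_mul]
    exact exists_sum_mul_volume_visitSet_le hv (by positivity) hrange hδ0 hδ
      (by push_cast; nlinarith [(Nat.cast_nonneg Z : (0 : ℝ) ≤ Z)]) hl s

end Column

/-! ### Forced paths -/

/-- A path `w` vanishing outside `(-a, a)` and satisfying `w'' = R - P` inside, where `P` is the
force which pushes it upwards and `R` is the resistance of the obstacles. -/
structure IsForcedPath (a : ℝ) (P R w : ℝ → ℝ) : Prop where
  continuous_push : Continuous P
  continuous_resistance : Continuous R
  push_nonneg : ∀ y, 0 ≤ P y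
  resistance_nonneg : ∀ y, 0 ≤ R y
  continuous : Continuous w
  eq_zero : ∀ y, a ≤ |y| → w y = 0
  exists_hasSecondDeriv : ∃ v, HasSecondDeriv v (fun y => R y - P y) ∧ EqOn w v (Icc (-a) a)

namespace IsForcedPath

variable {a : ℝ} {P R w : ℝ → ℝ}

theorem continuous_sub (h : IsForcedPath a P R w) : Continuous fun y => R y - P y :=
  h.continuous_resistance.sub h.continuous_push

theorem continuous_add (h : IsForcedPath a P R w) : Continuous fun y => P y + R y :=
  h.continuous_push.add h.continuous_resistance

theorem abs_sub_le_add (h : IsForcedPath a P R w) (y : ℝ) : |R y - P y| ≤ P y + R y :=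
  abs_le.2 ⟨by linarith [h.resistance_nonneg y], by linarith [h.push_nonneg y]⟩

theorem abs_second_difference_le (h : IsForcedPath a P R w) {m η : ℝ} (hη : 0 < η)
    (hm : -a ≤ m - η) (hm' : m + η ≤ a) :
    |w (m + η) - 2 * w m + w (m - η)| ≤ hatMass (fun y => P y + R y) (m - η) (m + η) := by
  obtain ⟨v, hv, hwv⟩ := h.exists_hasSecondDeriv
  rw [hwv ⟨by linarith, hm'⟩, hwv ⟨by linarith, by linarith⟩, hwv ⟨hm, by linarith⟩]
  exact hv.abs_second_difference_le h.continuous_sub h.continuous_add h.abs_sub_le_add hη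

theorem abs_secant_sub_le (h : IsForcedPath a P R w) {p r c y y' : ℝ} (hc : 0 < c) (hp : -a ≤ p)
    (hr : r ≤ a) (hy : p + c ≤ y) (hyy : y ≤ y') (hy' : y' ≤ r - c) :
    |(w r - w p) / (r - p) * (y' - y) - (w y' - w y)| ≤
      2 / c * hatMass (fun y => P y + R y) p r * (y' - y) := by
  obtain ⟨v, hv, hwv⟩ := h.exists_hasSecondDeriv
  rw [hwv ⟨by linarith, hr⟩, hwv ⟨hp, by linarith⟩, hwv ⟨by linarith, by linarith⟩,
    hwv ⟨by linarith, by linarith⟩]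
  exact hv.abs_secant_sub_le h.continuous_sub h.continuous_add h.abs_sub_le_add hc hy hyy hy'

theorem hatMass_push_le (h : IsForcedPath a P R w) {K x₀ : ℝ} (hK : 0 ≤ K)
    (hx₀ : x₀ ∈ Icc (-a) a) (hdip : w x₀ < K * (a - |x₀|)) :
    hatMass P (-a) a ≤ 2 * a * ((∫ y in (-a)..a, R y) + 2 * K) := by
  obtain ⟨v, hv, hwv⟩ := h.exists_hasSecondDeriv
  have hlt : |x₀| < a := by
    by_contra! hge
    rw [h.eq_zero x₀ hge, le_antisymm (abs_le.2 hx₀) hge, sub_self, mul_zero] at hdip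
    exact hdip.false
  have ha : 0 < a := (abs_nonneg _).trans_lt hlt
  have hleft : v (-a) = 0 := by
    rw [← hwv ⟨le_rfl, by linarith⟩]
    exact h.eq_zero _ ((le_abs_self a).trans_eq (abs_neg a).symm)
  have hright : v a = 0 := by
    rw [← hwv ⟨by linarith, le_rfl⟩]
    exact h.eq_zero _ (le_abs_self a)
  exact hv.hatMass_le_of_lt h.continuous_push h.continuous_resistance h.push_nonneg
    h.resistance_nonneg hleft hright hK hlt (hwv hx₀ ▸ hdip)

end IsForcedPath

theorem exists_tsum_obstacles_eq_sum {δ : ℝ} {φ : ℝ × ℝ → ℝ} (hφ : Continuous φ)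
    (hsupp : Function.support φ ⊆ obstacleSquare δ) (l : ℤ × ℤ → ℝ) (N : ℕ) (B : ℝ) :
    ∃ s : Finset ℤ, ∀ x t : ℝ, |x| ≤ N - δ → |t| ≤ B →
      ∑' p, l p * φ ((x, t) - latticeNode p) =
        ∑ p ∈ columns N ×ˢ s, l p * φ ((x, t) - latticeNode p) := by
  obtain ⟨n, hn⟩ := exists_nat_ge (B + δ + 1)
  refine ⟨columns n, fun x t hx ht => tsum_eq_sum fun p hp => ?_⟩
  have hle : ∀ {N : ℕ} {i : ℤ}, i ∉ columns N → (N : ℝ) ≤ |(i : ℝ)| := fun hi => by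
    rw [mem_columns, not_le, Int.lt_add_one_iff] at hi
    exact_mod_cast hi
  rw [Finset.mem_product, not_and_or] at hp
  refine mul_eq_zero_of_right _ (eq_zero_of_support_subset_obstacleSquare hφ hsupp
    (hp.imp (fun hi => ?_) fun hj => ?_))
  · change δ ≤ |x - p.1|
    have : |(p.1 : ℝ)| ≤ |x - p.1| + |x| := by grind
    linarith [hle hi]
  · change δ ≤ |t - (p.2 + 1 / 2)|
    have : |(p.2 : ℝ)| ≤ |t - (p.2 + 1 / 2)| + |t| + 1 / 2 := by grind
    linarith [hle hj]

theorem IsDirichletSolution.exists_isForcedPath {δ F : ℝ} {φ g : ℝ × ℝ → ℝ} {l : ℤ × ℤ → ℝ}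
    {N : ℕ} {u : ℝ → ℝ} (hδ : δ < N) (hφ : Continuous φ) (hφ0 : ∀ z, 0 ≤ φ z)
    (hsupp : Function.support φ ⊆ obstacleSquare δ) (hl : ∀ p, 0 ≤ l p) (hg : Continuous g)
    (hg0 : ∀ z, 0 ≤ g z) (hF : 0 ≤ F)
    (hu : IsDirichletSolution (obstacleField φ g l) F (-(N - δ)) (N - δ) u) :
    ∃ (w : ℝ → ℝ) (s : Finset ℤ),
      IsForcedPath (N - δ) (fun y => F + g (y, w y))
        (fun y => ∑ p ∈ columns N ×ˢ s, l p * φ ((y, w y) - latticeNode p)) w ∧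
      EqOn w u (Icc (-(N - δ)) (N - δ)) := by
  set a : ℝ := N - δ
  have hlt : -a < a := by linarith
  set w : ℝ → ℝ := IccExtend hlt.le ((Icc (-a) a).domRestrict u) with hw_def
  have hw : Continuous w :=
    (continuousOn_iff_continuous_domRestrict.1 hu.continuousOn).Icc_extend'
  have hwu : EqOn w u (Icc (-a) a) := fun y hy => by
    rw [hw_def, IccExtend_of_mem _ _ hy, domRestrict_apply]
  obtain ⟨B, hB⟩ := isCompact_Icc.exists_bound_of_continuousOn hu.continuousOn
  obtain ⟨s, hs⟩ := exists_tsum_obstacles_eq_sum hφ hsupp l N B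
  have hP : Continuous fun y => F + g (y, w y) := by fun_prop
  have hR : Continuous fun y => ∑ p ∈ columns N ×ˢ s, l p * φ ((y, w y) - latticeNode p) :=
    continuous_finsetSum _ fun p _ => by fun_prop
  obtain ⟨v, hv, huv⟩ := exists_hasSecondDeriv_eqOn_Icc hlt (hR.sub hP) hu.continuousOn
    hu.contDiffOn fun y hy => by
      have hy' := Ioo_subset_Icc_self hy
      have heq := hu.equation y hy
      rw [obstacleField, hs y (u y) (abs_le.2 hy') (hB y hy'), ← hwu hy'] at heq
      simp only [Pi.sub_apply]
      linarith
  refine ⟨w, s, ⟨hP, hR, fun y => add_nonneg hF (hg0 _),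
    fun y => Finset.sum_nonneg fun p _ => mul_nonneg (hl p) (hφ0 _), hw, fun y hy => ?_,
    v, hv, hwu.trans huv⟩, hwu⟩
  rcases le_abs.1 hy with hy | hy
  · rw [hw_def, IccExtend_of_right_le _ _ hy]
    exact hu.right
  · rw [hw_def, IccExtend_of_le_left _ _ (by linarith)]
    exact hu.left

/-! ### Discrete paths -/

/-- The discrete trace of a path across the columns `|i| < N`: in each column an integer height, a
budget for the curvature of the path, and the position, relative to the height, of the obstacle
which is charged when the path does not cross the column steeply. -/
structure DiscretePath (N : ℕ) where
  height : ℤ → ℤ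
  curv : columns N → ℕ
  mark : columns N → ℤ
  height_eq_zero : ∀ i ∉ columns N, height i = 0

/-- The weight of the column `i` in the energy of a discrete path: the Green function of `-d²/dz²`
on `[-N, N]` with pole at `0`, divided by `N`. -/
noncomputable def columnWeight (N : ℕ) (i : ℤ) : ℝ := (N - |(i : ℝ)|) / (2 * N)

theorem abs_le_of_mem_columns {N : ℕ} {i : ℤ} (hi : i ∈ columns N) : |(i : ℝ)| ≤ N - 1 :=
  le_sub_iff_add_le.2 (by exact_mod_cast mem_columns.1 hi)

theorem columnWeight_pos {N : ℕ} {i : ℤ} (hi : i ∈ columns N) : 0 < columnWeight N i := by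
  have hle := abs_le_of_mem_columns hi
  have := abs_nonneg (i : ℝ)
  exact div_pos (by linarith) (by linarith)

theorem columnWeight_le (N : ℕ) (i : ℤ) : columnWeight N i ≤ 1 / 2 :=
  div_le_of_le_mul₀ (by positivity) (by norm_num) (by linarith [abs_nonneg (i : ℝ)])

namespace DiscretePath

variable {N : ℕ} (ξ : DiscretePath N)

/-- The second difference of the heights at column `i`. -/
def secondDifference (i : ℤ) : ℤ := ξ.height (i + 1) - 2 * ξ.height i + ξ.height (i - 1)

/-- The size of the symmetric difference of the heights at column `i`, which is the number of unit
cells that the path has to cross there. -/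
def slope (i : ℤ) : ℕ := (ξ.height (i + 1) - ξ.height (i - 1)).natAbs

/-- The constraints which the curvature budget puts on a discrete path. -/
structure IsAdmissible (A : ℕ) : Prop where
  abs_secondDifference_le : ∀ i : columns N,
    |ξ.secondDifference i| ≤ ξ.curv i + 2
  abs_mark_le : ∀ i, |ξ.mark i| ≤ (2 * A + 2) * (ξ.curv i + 1)

/-- The curvature budget of a discrete path, weighted by `columnWeight`. -/
noncomputable def energy : ℝ := ∑ i : columns N, columnWeight N i * ξ.curv i

/-- The ordinates of the obstacles in column `i` which a discrete path is charged for. -/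
noncomputable def obstacles (A : ℕ) (i : columns N) : Finset ℤ :=
  chargedNodes A (ξ.curv i) (ξ.slope i) (ξ.height i) (ξ.mark i)

/-- The time which a discrete path is charged for at each of its obstacles in column `i`. -/
noncomputable def weight (A : ℕ) (i : columns N) : ℝ := chargeWeight A (ξ.curv i) (ξ.slope i)

/-- The weighted sum of the strengths of the obstacles which a discrete path is charged for. -/
noncomputable def charge (A : ℕ) (l : ℤ × ℤ → ℝ) : ℝ :=
  ∑ i : columns N, ∑ j ∈ ξ.obstacles A i, ξ.weight A i * l (i, j)

end DiscretePath

theorem abs_floor_second_difference_le {x y z : ℝ} {n : ℕ} (h : |x - 2 * y + z| ≤ n) :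
    |⌊x⌋ - 2 * ⌊y⌋ + ⌊z⌋| ≤ (n : ℤ) + 2 := by
  have hx := Int.floor_le x
  have hx' := Int.lt_floor_add_one x
  have hy := Int.floor_le y
  have hy' := Int.lt_floor_add_one y
  have hz := Int.floor_le z
  have hz' := Int.lt_floor_add_one z
  obtain ⟨h₁, h₂⟩ := abs_le.1 h
  have hreal : |(⌊x⌋ : ℝ) - 2 * ⌊y⌋ + ⌊z⌋| ≤ n + 2 :=
    abs_le.2 ⟨by linarith, by linarith⟩
  exact_mod_cast hreal

theorem abs_abs_sub_natAbs_floor_le (x z : ℝ) : |(|x - z| - ((⌊x⌋ - ⌊z⌋).natAbs : ℝ))| ≤ 1 := by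
  rw [Nat.cast_natAbs, Int.cast_abs, Int.cast_sub]
  refine (abs_abs_sub_abs_le_abs_sub _ _).trans (abs_le.2 ⟨?_, ?_⟩) <;>
    linarith [Int.floor_le x, Int.lt_floor_add_one x, Int.floor_le z, Int.lt_floor_add_one z]

section Discretization

variable {δ η : ℝ} {N : ℕ} {P R w : ℝ → ℝ}

theorem half_le_of_mul_eq (hδ : δ < 1 / 2) (hη : N * η = N - δ) (hN : 1 ≤ N) : 1 / 2 ≤ η := by
  have hN' : (1 : ℝ) ≤ N := by exact_mod_cast hN
  nlinarith

theorem le_one_of_mul_eq (hδ0 : 0 ≤ δ) (hη : N * η = N - δ) (hN : 1 ≤ N) : η ≤ 1 := by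
  have hN' : (1 : ℝ) ≤ N := by exact_mod_cast hN
  nlinarith

theorem abs_sub_mul_le (hδ0 : 0 ≤ δ) (hη : N * η = N - δ) {i : ℤ} (hi : i ∈ columns N) :
    |i - i * η| ≤ η - 1 + δ := by
  have hi' := abs_le_of_mem_columns hi
  have hN : 1 ≤ N := by have := mem_columns.1 hi; have := abs_nonneg i; omega
  have hη1 := le_one_of_mul_eq hδ0 hη hN
  rw [← mul_one_sub, abs_mul, abs_of_nonneg (sub_nonneg.2 hη1)]
  nlinarith

namespace IsForcedPath

theorem exists_mark (h : IsForcedPath (N - δ) P R w) (hδ0 : 0 ≤ δ) (hδ : δ < 1 / 2)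
    (hη : N * η = N - δ) {A : ℕ} (hA : 2 * (1 + 4 / (1 - 2 * δ)) ≤ A) {l : ℤ × ℤ → ℝ}
    (hl : ∀ p, 0 ≤ l p) (s : Finset ℤ) {i : ℤ} (hi : i ∈ columns N) {Z : ℕ}
    (hZ : hatMass (fun y => P y + R y) (i * η - η) (i * η + η) ≤ Z) :
    ∃ m : ℤ, |m| ≤ (2 * A + 2) * (Z + 1) ∧
      ∑ j ∈ s, l (i, j) * volume.real (visitSet δ i w j) ≤
        ∑ j ∈ chargedNodes A Z (⌊w (i * η + η)⌋ - ⌊w (i * η - η)⌋).natAbs ⌊w (i * η)⌋ m,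
          chargeWeight A Z (⌊w (i * η + η)⌋ - ⌊w (i * η - η)⌋).natAbs * l (i, j) := by
  have hN : 1 ≤ N := by have := mem_columns.1 hi; have := abs_nonneg i; omega
  have hη1 := le_one_of_mul_eq hδ0 hη hN
  have hη2 := half_le_of_mul_eq hδ hη hN
  obtain ⟨hcol₁, hcol₂⟩ := abs_le.1 (abs_sub_mul_le hδ0 hη hi)
  obtain ⟨hi₁, hi₂⟩ := abs_le.1 (abs_le_of_mem_columns hi)
  obtain ⟨hfl₁, hfl₂⟩ := abs_le.1
    (abs_abs_sub_natAbs_floor_le (w (i * η + η)) (w (i * η - η)))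
  have hc : 0 < 1 - 2 * δ := by linarith
  set S : ℝ := (w (i * η + η) - w (i * η - η)) / (i * η + η - (i * η - η)) with hS
  have hS0 := abs_nonneg S
  have hslope : |S| * (2 * η) = |w (i * η + η) - w (i * η - η)| := by
    rw [hS, show i * η + η - (i * η - η) = 2 * η by ring, abs_div,
      abs_of_pos (by linarith : 0 < 2 * η), div_mul_cancel₀ _ (by linarith)]
  refine exists_mark_sum_mul_volume_visitSet_le (x := i * η) (S := S) (C := 2 / (1 - 2 * δ))
    h.continuous hδ0 hδ ⟨by linarith, by linarith⟩ (by positivity) (fun y hy y' hy' hyy => ?_)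
    (by nlinarith) (by nlinarith) (le_of_eq_of_le (by ring) hA) (fun j => hl (i, j)) s
  calc |S * (y' - y) - (w y' - w y)|
      ≤ 2 / (1 - 2 * δ) * hatMass (fun y => P y + R y) (i * η - η) (i * η + η) * (y' - y) :=
        h.abs_secant_sub_le hc (by nlinarith) (by nlinarith) (by linarith [hy.1]) hyy
          (by linarith [hy'.2])
    _ ≤ 2 / (1 - 2 * δ) * Z * (y' - y) := by
        have := sub_nonneg.2 hyy
        gcongr

theorem sum_columnWeight_mul_ceil_le (h : IsForcedPath (N - δ) P R w) (hη0 : 0 < η)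
    (hη : N * η = N - δ) :
    ∑ i : columns N, columnWeight N i *
        (⌈hatMass (fun y => P y + R y) (i * η - η) (i * η + η)⌉₊ : ℝ) ≤
      hatMass (fun y => P y + R y) (-(N - δ)) (N - δ) / (2 * N) + N := by
  set mass : ℤ → ℝ := fun i => hatMass (fun y => P y + R y) (i * η - η) (i * η + η)
  have hmass0 : ∀ i, 0 ≤ mass i := fun i =>
    hatMass_nonneg (fun y => add_nonneg (h.push_nonneg y) (h.resistance_nonneg y)) (by linarith)
  have hcard : ((columns N).card : ℝ) ≤ 2 * N := by exact_mod_cast card_columns_le N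
  calc ∑ i : columns N, columnWeight N i * (⌈mass i⌉₊ : ℝ)
      = ∑ i ∈ columns N, columnWeight N i * (⌈mass i⌉₊ : ℝ) :=
        Finset.sum_coe_sort (columns N) fun i => columnWeight N i * (⌈mass i⌉₊ : ℝ)
    _ ≤ ∑ i ∈ columns N, ((N - |(i : ℝ)|) * mass i / (2 * N) + 1 / 2) := by
        refine Finset.sum_le_sum fun i hi => ?_
        have hceil := mul_le_mul_of_nonneg_left (Nat.ceil_lt_add_one (hmass0 i)).le
          (columnWeight_pos hi).le
        rw [mul_add_one] at hceil
        exact hceil.trans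
          (add_le_add (div_mul_eq_mul_div _ _ _).le (columnWeight_le N i))
    _ ≤ hatMass (fun y => P y + R y) (-(N - δ)) (N - δ) / (2 * N) + N := by
        rw [Finset.sum_add_distrib, ← Finset.sum_div,
          sum_columns_mul_hatMass h.continuous_add hη0, hη, Finset.sum_const, nsmul_eq_mul]
        linarith

theorem exists_discretePath (h : IsForcedPath (N - δ) P R w) (hδ0 : 0 ≤ δ) (hδ : δ < 1 / 2)
    (hN : 1 ≤ N) {A : ℕ} (hA : 2 * (1 + 4 / (1 - 2 * δ)) ≤ A) {l : ℤ × ℤ → ℝ}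
    (hl : ∀ p, 0 ≤ l p) (s : Finset ℤ) :
    ∃ ξ : DiscretePath N, ξ.IsAdmissible A ∧
      ξ.energy ≤ hatMass (fun y => P y + R y) (-(N - δ)) (N - δ) / (2 * N) + N ∧
      ∑ i ∈ columns N, ∑ j ∈ s, l (i, j) * volume.real (visitSet δ i w j) ≤ ξ.charge A l := by
  have hN0 : (0 : ℝ) < N := by exact_mod_cast hN
  obtain ⟨η, hη⟩ : ∃ η : ℝ, N * η = N - δ := ⟨(N - δ) / N, mul_div_cancel₀ _ hN0.ne'⟩
  have hη2 := half_le_of_mul_eq hδ hη hN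
  have hsucc : ∀ i : ℤ, ((i + 1 : ℤ) : ℝ) * η = i * η + η := fun i => by push_cast; ring
  have hpred : ∀ i : ℤ, ((i - 1 : ℤ) : ℝ) * η = i * η - η := fun i => by push_cast; ring
  choose mark hmark hcharge using fun i : columns N =>
    h.exists_mark hδ0 hδ hη hA hl s i.2 (Nat.le_ceil _)
  refine ⟨⟨fun i => ⌊w (i * η)⌋,
    fun i => ⌈hatMass (fun y => P y + R y) (i * η - η) (i * η + η)⌉₊, mark, fun i hi => ?_⟩,
    ⟨fun i => ?_, hmark⟩, h.sum_columnWeight_mul_ceil_le (by linarith) hη, ?_⟩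
  · have hi' : (N : ℝ) ≤ |(i : ℝ)| := by
      rw [mem_columns, not_le, Int.lt_add_one_iff] at hi
      exact_mod_cast hi
    rw [h.eq_zero _ (by rw [abs_mul, abs_of_pos (by linarith : 0 < η)]; nlinarith),
      Int.floor_zero]
  · obtain ⟨hi₁, hi₂⟩ := abs_le.1 (abs_le_of_mem_columns i.2)
    simp only [DiscretePath.secondDifference, hsucc, hpred]
    exact abs_floor_second_difference_le ((h.abs_second_difference_le (by linarith)
      (by nlinarith) (by nlinarith)).trans (Nat.le_ceil _))
  · rw [← Finset.sum_coe_sort]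
    simp only [DiscretePath.charge, DiscretePath.obstacles, DiscretePath.weight,
      DiscretePath.slope, hsucc, hpred]
    exact Finset.sum_le_sum fun i _ => hcharge i

theorem hatMass_div_add_mul_le (h : IsForcedPath (N - δ) P R w) (hδ0 : 0 ≤ δ) (hδ : δ < 1 / 2)
    (hN : 1 ≤ N) {F K x₀ : ℝ} (hF : 0 ≤ F) (hFP : ∀ y, F ≤ P y) (hK : 0 ≤ K)
    (hx₀ : x₀ ∈ Icc (-(N - δ)) (N - δ)) (hdip : w x₀ < K * (N - δ - |x₀|)) :
    hatMass (fun y => P y + R y) (-(N - δ)) (N - δ) / (2 * N) + F * N ≤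
      6 * (∫ y in (-(N - δ))..(N - δ), R y) + 10 * K := by
  have hN1 : (1 : ℝ) ≤ N := by exact_mod_cast hN
  have ha : 0 < N - δ := by linarith
  set T : ℝ := ∫ y in (-(N - δ))..(N - δ), R y
  have hT : 0 ≤ T :=
    intervalIntegral.integral_nonneg (by linarith) fun y _ => h.resistance_nonneg y
  have hpush := h.hatMass_push_le hK hx₀ hdip
  have hresist := hatMass_le h.continuous_resistance h.resistance_nonneg ha.le
  have hforce : F * N ≤ 4 * (T + 2 * K) := by
    have hmono := (hatMass_mono continuous_const h.continuous_push hFP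
      (by linarith : -(N - δ) ≤ N - δ)).trans hpush
    rw [hatMass_const F ha] at hmono
    have hFa : F * (N - δ) ≤ 2 * (T + 2 * K) := le_of_mul_le_mul_right (by linarith) ha
    nlinarith
  have hmass : hatMass (fun y => P y + R y) (-(N - δ)) (N - δ) / (2 * N) ≤
      (3 * T + 4 * K) / 2 := by
    rw [hatMass_add h.continuous_push h.continuous_resistance, div_le_iff₀ (by linarith)]
    nlinarith
  linarith

end IsForcedPath

theorem IsDirichletSolution.exists_charged_discretePath {M K F : ℝ} {φ g : ℝ × ℝ → ℝ}
    {l : ℤ × ℤ → ℝ} {A : ℕ} {u : ℝ → ℝ} {x₀ : ℝ} (hδ0 : 0 ≤ δ) (hδ : δ < 1 / 2) (hN : 1 ≤ N)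
    (hA : 2 * (1 + 4 / (1 - 2 * δ)) ≤ A) (hφ : Continuous φ) (hφ0 : ∀ z, 0 ≤ φ z)
    (hsupp : Function.support φ ⊆ obstacleSquare δ) (hM0 : 0 ≤ M) (hM : ∀ z, φ z ≤ M)
    (hl : ∀ p, 0 ≤ l p) (hg : Continuous g) (hg0 : ∀ z, 0 ≤ g z) (hF : 0 ≤ F) (hK : 0 ≤ K)
    (hu : IsDirichletSolution (obstacleField φ g l) F (-(N - δ)) (N - δ) u)
    (hx₀ : x₀ ∈ Icc (-(N - δ)) (N - δ)) (hdip : u x₀ < K * (N - δ - |x₀|)) :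
    ∃ ξ : DiscretePath N, ξ.IsAdmissible A ∧
      ξ.energy + (F - (10 * K + 1)) * N ≤ 6 * (M * ξ.charge A l) := by
  have hN1 : (1 : ℝ) ≤ N := by exact_mod_cast hN
  obtain ⟨w, s, h, hwu⟩ := hu.exists_isForcedPath (by linarith) hφ hφ0 hsupp hl hg hg0 hF
  obtain ⟨ξ, hξ, henergy, hcharge⟩ := h.exists_discretePath hδ0 hδ hN hA hl s
  refine ⟨ξ, hξ, ?_⟩
  have hbudget := h.hatMass_div_add_mul_le hδ0 hδ hN hF
    (fun y => le_add_of_nonneg_right (hg0 _)) hK hx₀ (hwu hx₀ ▸ hdip)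
  have hresistance := (integral_sum_profile_le hφ hsupp hM0 hM h.continuous
    (by linarith : 0 ≤ (N : ℝ) - δ) hl (columns N) s).trans
    (mul_le_mul_of_nonneg_left hcharge hM0)
  nlinarith

end Discretization

/-! ### Exponential tails -/

section Chernoff

variable {Ω : Type*} [MeasurableSpace Ω] {P : Measure Ω}

theorem measureReal_sum_ge_le_exp {ι : Type*} {X : ι → Ω → ℝ} (hindep : iIndepFun X P)
    (hmeas : ∀ i, Measurable (X i)) {S : Finset ι} {b : ι → ℝ}
    (hint : ∀ i ∈ S, Integrable (fun ω => Real.exp (X i ω)) P)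
    (hmgf : ∀ i ∈ S, mgf (X i) P 1 ≤ Real.exp (b i)) (t : ℝ) :
    P.real {ω | t ≤ ∑ i ∈ S, X i ω} ≤ Real.exp (∑ i ∈ S, b i - t) := by
  have := hindep.isProbabilityMeasure
  have hchernoff := measure_ge_le_exp_mul_mgf t zero_le_one
    (hindep.integrable_exp_mul_sum hmeas (t := 1) (s := S) (by simpa only [one_mul] using hint))
  simp only [Finset.sum_apply] at hchernoff
  calc P.real {ω | t ≤ ∑ i ∈ S, X i ω}
      ≤ Real.exp (-1 * t) * mgf (∑ i ∈ S, X i) P 1 := hchernoff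
    _ ≤ Real.exp (-1 * t) * Real.exp (∑ i ∈ S, b i) := by
        rw [hindep.mgf_sum hmeas, Real.exp_sum]
        gcongr with i hi
        · exact fun i _ => mgf_nonneg
        · exact hmgf i hi
    _ = Real.exp (∑ i ∈ S, b i - t) := by
        rw [← Real.exp_add]
        ring_nf

theorem lintegral_exp_mul_expMeasure {lam c : ℝ} (hlam : 0 < lam) (hc : c < lam) :
    ∫⁻ x, ENNReal.ofReal (Real.exp (c * x)) ∂expMeasure lam =
      ENNReal.ofReal (lam / (lam - c)) := by
  have hsub : 0 < lam - c := sub_pos.2 hc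
  have hpdf : Measurable (exponentialPDF (lam - c)) :=
    (measurable_exponentialPDFReal _).ennreal_ofReal
  have htilt : ∀ x, exponentialPDF lam x * ENNReal.ofReal (Real.exp (c * x)) =
      ENNReal.ofReal (lam / (lam - c)) * exponentialPDF (lam - c) x := fun x => by
    rcases lt_or_ge x 0 with hx | hx
    · rw [exponentialPDF_of_neg hx, exponentialPDF_of_neg hx, zero_mul, mul_zero]
    · rw [exponentialPDF_of_nonneg hx, exponentialPDF_of_nonneg hx,
        ← ENNReal.ofReal_mul (by positivity), ← ENNReal.ofReal_mul (by positivity), mul_assoc,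
        ← Real.exp_add, ← mul_assoc, div_mul_cancel₀ _ hsub.ne']
      ring_nf
  calc ∫⁻ x, ENNReal.ofReal (Real.exp (c * x)) ∂expMeasure lam
      = ∫⁻ x, exponentialPDF lam x * ENNReal.ofReal (Real.exp (c * x)) :=
        lintegral_withDensity_eq_lintegral_mul _
          (measurable_exponentialPDFReal lam).ennreal_ofReal (by fun_prop)
    _ = ENNReal.ofReal (lam / (lam - c)) := by
        simp only [htilt]
        rw [lintegral_const_mul _ hpdf, lintegral_exponentialPDF_eq_one hsub, mul_one]

namespace IsIIDExponential

variable {lam : ℝ} {l : ℤ × ℤ → Ω → ℝ}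

theorem ae_pos (h : IsIIDExponential P lam l) : ∀ᵐ ω ∂P, ∀ p, 0 < l p ω := by
  have := h.indep.isProbabilityMeasure
  refine ae_all_iff.2 fun p => ?_
  have htail := h.tail p 0 le_rfl
  rw [mul_zero, Real.exp_zero, ENNReal.ofReal_one] at htail
  exact (prob_compl_eq_zero_iff (measurableSet_lt measurable_const (h.measurable p))).2 htail

theorem map_eq_expMeasure (hlam : 0 < lam) (h : IsIIDExponential P lam l) (p : ℤ × ℤ) :
    P.map (l p) = expMeasure lam := by
  have := h.indep.isProbabilityMeasure
  have := isProbabilityMeasure_expMeasure hlam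
  have := Measure.isProbabilityMeasure_map (μ := P) (h.measurable p).aemeasurable
  refine Measure.eq_of_cdf _ _ (StieltjesFunction.ext fun x => ?_)
  rw [cdf_expMeasure_eq hlam, cdf_eq_real, map_measureReal_apply (h.measurable p) measurableSet_Iic]
  split_ifs with hx
  · have hcompl : l p ⁻¹' Iic x = {ω | x < l p ω}ᶜ := by ext; simp
    rw [hcompl, probReal_compl_eq_one_sub (measurableSet_lt measurable_const (h.measurable p)),
      measureReal_def, h.tail p x hx, ENNReal.toReal_ofReal (Real.exp_pos _).le, neg_mul]
  · rw [measureReal_eq_zero_iff]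
    refine measure_mono_null (fun ω hω => ?_) (ae_iff.1 (ae_all_iff.1 h.ae_pos p))
    exact not_lt.2 (le_trans hω (not_le.1 hx).le)

theorem lintegral_exp_mul (hlam : 0 < lam) (h : IsIIDExponential P lam l) (p : ℤ × ℤ) {c : ℝ}
    (hc : c < lam) :
    ∫⁻ ω, ENNReal.ofReal (Real.exp (c * l p ω)) ∂P = ENNReal.ofReal (lam / (lam - c)) := by
  rw [← lintegral_exp_mul_expMeasure hlam hc, ← h.map_eq_expMeasure hlam p,
    lintegral_map (by fun_prop) (h.measurable p)]

theorem integrable_exp_mul (hlam : 0 < lam) (h : IsIIDExponential P lam l) (p : ℤ × ℤ) {c : ℝ}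
    (hc : c < lam) : Integrable (fun ω => Real.exp (c * l p ω)) P := by
  have hmeas := h.measurable p
  refine ⟨by fun_prop, ?_⟩
  rw [hasFiniteIntegral_iff_ofReal (ae_of_all _ fun ω => (Real.exp_pos _).le),
    h.lintegral_exp_mul hlam p hc]
  exact ENNReal.ofReal_lt_top

theorem mgf_le (hlam : 0 < lam) (h : IsIIDExponential P lam l) (p : ℤ × ℤ) {c : ℝ} (hc : 0 ≤ c)
    (hc' : c ≤ lam / 2) : mgf (l p) P c ≤ Real.exp (2 / lam * c) := by
  have hsub : 0 < lam - c := by linarith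
  calc mgf (l p) P c = lam / (lam - c) := by
        rw [mgf, integral_eq_lintegral_of_nonneg_ae (ae_of_all _ fun ω => (Real.exp_pos _).le)
          (h.integrable_exp_mul hlam p (by linarith)).aestronglyMeasurable,
          h.lintegral_exp_mul hlam p (by linarith), ENNReal.toReal_ofReal (by positivity)]
    _ ≤ 2 / lam * c + 1 := by
        rw [div_le_iff₀ hsub]
        have : (2 / lam * c + 1) * (lam - c) = lam + c / lam * (lam - 2 * c) := by
          field_simp
          ring
        rw [this]
        exact le_add_of_nonneg_right (mul_nonneg (by positivity) (by linarith))
    _ ≤ Real.exp (2 / lam * c) := Real.add_one_le_exp _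

end IsIIDExponential

end Chernoff

namespace DiscretePath

variable {Ω : Type*} [MeasurableSpace Ω] {P : Measure Ω} {lam : ℝ} {l : ℤ × ℤ → Ω → ℝ} {N : ℕ}
  (ξ : DiscretePath N)

theorem measurable_charge (hl : ∀ p, Measurable (l p)) (A : ℕ) :
    Measurable fun ω => ξ.charge A fun p => l p ω :=
  Finset.measurable_sum _ fun _ _ => Finset.measurable_sum _ fun _ _ => (hl _).const_mul _

theorem sum_weight_le {A : ℕ} (hA : 1 ≤ A) :
    ∑ i, ∑ _j ∈ ξ.obstacles A i, ξ.weight A i ≤ 72 * N := by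
  have hcard : ((columns N).card : ℝ) ≤ 2 * N := by exact_mod_cast card_columns_le N
  calc ∑ i, ∑ _j ∈ ξ.obstacles A i, ξ.weight A i
      ≤ ∑ _i : columns N, 36 := Finset.sum_le_sum fun _ _ => sum_chargeWeight_le hA _ _ _ _
    _ ≤ 72 * N := by
        rw [Finset.sum_const, Finset.card_univ, Fintype.card_coe, nsmul_eq_mul]
        linarith

theorem measureReal_charge_ge_le (hlam : 0 < lam) (h : IsIIDExponential P lam l) {A : ℕ}
    (hA : 1 ≤ A) (t : ℝ) :
    P.real {ω | t ≤ ξ.charge A fun p => l p ω} ≤ Real.exp (18 * N - lam / 8 * t) := by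
  set X : (Σ _ : columns N, ℤ) → Ω → ℝ :=
    fun q ω => lam / 8 * ξ.weight A q.1 * l (q.1, q.2) ω with hX
  set S : Finset (Σ _ : columns N, ℤ) := Finset.univ.sigma (ξ.obstacles A) with hS
  have hweight : ∀ i, 0 ≤ lam / 8 * ξ.weight A i := fun i =>
    mul_nonneg (by positivity) (chargeWeight_nonneg _ _ _)
  have hweight' : ∀ i, lam / 8 * ξ.weight A i ≤ lam / 2 := fun i => by
    have := mul_le_mul_of_nonneg_left (chargeWeight_le hA (ξ.curv i) (ξ.slope i)) hlam.le
    rw [DiscretePath.weight]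
    linarith
  have hindep : iIndepFun X P :=
    (h.indep.precomp (g := fun q : Σ _ : columns N, ℤ => ((q.1 : ℤ), q.2)) fun q q' hq => by
      obtain ⟨h₁, h₂⟩ := Prod.mk.inj hq
      exact Sigma.ext (Subtype.ext h₁) (heq_of_eq h₂)).comp
      (fun q x => lam / 8 * ξ.weight A q.1 * x) fun q => measurable_const_mul _
  have hcharge : ∀ ω, ∑ q ∈ S, X q ω = lam / 8 * ξ.charge A fun p => l p ω := fun ω => by
    simp only [hS, hX, Finset.sum_sigma, charge, Finset.mul_sum, mul_assoc]
  have htotal : ∑ q ∈ S, 2 / lam * (lam / 8 * ξ.weight A q.1) ≤ 18 * N := by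
    calc ∑ q ∈ S, 2 / lam * (lam / 8 * ξ.weight A q.1)
        = 1 / 4 * ∑ i, ∑ _j ∈ ξ.obstacles A i, ξ.weight A i := by
          simp only [hS, Finset.sum_sigma, Finset.mul_sum]
          refine Finset.sum_congr rfl fun i _ => Finset.sum_congr rfl fun j _ => ?_
          field_simp
          ring
      _ ≤ 18 * N := by linarith [ξ.sum_weight_le hA]
  have hchernoff := measureReal_sum_ge_le_exp (S := S) hindep
    (fun q => (h.measurable _).const_mul _)
    (fun q _ => h.integrable_exp_mul hlam _ ((hweight' q.1).trans_lt (by linarith)))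
    (fun q _ => (mgf_const_mul _).trans_le
      ((mul_one (lam / 8 * ξ.weight A q.1)).symm ▸ h.mgf_le hlam _ (hweight q.1) (hweight' q.1)))
    (lam / 8 * t)
  simp only [hcharge, mul_one, mul_le_mul_iff_right₀ (by positivity : 0 < lam / 8)] at hchernoff
  exact hchernoff.trans (Real.exp_le_exp.2 (by linarith))

end DiscretePath

/-! ### Entropy of discrete paths -/

theorem eq_mul_of_second_difference_eq_zero {G : ℕ → ℤ} {n : ℕ} (h0 : G 0 = 0)
    (h : ∀ k < n, G (k + 2) - 2 * G (k + 1) + G k = 0) : ∀ k ≤ n + 1, G k = k * G 1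
  | 0, _ => by rw [h0, Nat.cast_zero, zero_mul]
  | 1, _ => by rw [Nat.cast_one, one_mul]
  | k + 2, hk => by
    have h₁ := eq_mul_of_second_difference_eq_zero h0 h (k + 1) (by omega)
    have h₂ := eq_mul_of_second_difference_eq_zero h0 h k (by omega)
    have h₃ := h k (by omega)
    push_cast at h₁ ⊢
    linarith

theorem eq_zero_of_second_difference_eq_zero {N : ℕ} {G : ℤ → ℤ} (h0 : ∀ i ∉ columns N, G i = 0)
    (h : ∀ i ∈ columns N, G (i + 1) - 2 * G i + G (i - 1) = 0) (i : ℤ) : G i = 0 := by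
  by_cases hi : i ∈ columns N
  swap
  · exact h0 i hi
  have hi' := Finset.mem_Ioo.1 hi
  have hout : ∀ k : ℤ, |k| = N → G k = 0 := fun k hk => h0 k (by rw [mem_columns]; omega)
  have hlinear : ∀ k ≤ 2 * N, G (-N + (k : ℕ)) = k * G (-N + (1 : ℕ)) := fun k hk =>
    eq_mul_of_second_difference_eq_zero (G := fun k : ℕ => G (-N + k)) (n := 2 * N - 1)
      (hout _ (by simp)) (fun k hk => by
        have := h (-N + (k + 1 : ℕ)) (Finset.mem_Ioo.2 (by push_cast; omega))
        convert this using 3 <;> push_cast <;> ring_nf) k (by omega)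
  have hslope : G (-N + (1 : ℕ)) = 0 := by
    have hend := hlinear (2 * N) le_rfl
    rw [hout _ (by push_cast; rw [two_mul, neg_add_cancel_left]; simp)] at hend
    exact (mul_eq_zero.1 hend.symm).resolve_left (by push_cast; omega)
  have := hlinear (i + N).toNat (by omega)
  rwa [hslope, mul_zero, Int.toNat_of_nonneg (by omega), neg_add_cancel_comm_assoc] at this

theorem prod_columns_natAbs_le {f : ℕ → ℝ} {N : ℕ} (hf : ∀ k < N, 1 ≤ f k) :
    ∏ i ∈ columns N, f i.natAbs ≤ (∏ k ∈ Finset.range N, f k) ^ 2 := by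
  rcases N with _ | n
  · simp [columns]
  rw [columns_succ]
  induction n with
  | zero => simpa using le_self_pow₀ (hf 0 zero_lt_one) two_ne_zero
  | succ n ih =>
    have hends : Finset.Icc (-((n + 1 : ℕ) : ℤ)) (n + 1 : ℕ) =
        insert ((n + 1 : ℕ) : ℤ) (insert (-((n + 1 : ℕ) : ℤ)) (Finset.Icc (-(n : ℤ)) n)) := by
      ext i
      simp only [Finset.mem_Icc, Finset.mem_insert]
      omega
    rw [hends, Finset.prod_insert (by simp only [Finset.mem_insert, Finset.mem_Icc]; omega),
      Finset.prod_insert (by simp), Int.natAbs_neg, Int.natAbs_natCast, Finset.prod_range_succ,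
      mul_pow, ← mul_assoc, ← sq, mul_comm]
    exact mul_le_mul_of_nonneg_right (ih fun k hk => hf k (by omega)) (by positivity)

theorem prod_range_div_sub (c : ℝ) (N : ℕ) :
    ∏ k ∈ Finset.range N, c / (N - k) = c ^ N / (N.factorial : ℝ) := by
  rw [Finset.prod_div_distrib, Finset.prod_const, Finset.card_range,
    ← Finset.prod_range_add_one_eq_factorial, Nat.cast_prod, ← Finset.prod_range_reflect]
  congr 1
  refine Finset.prod_congr rfl fun k hk => ?_
  have := Finset.mem_range.1 hk
  rw [show N - 1 - k = N - (k + 1) by omega, Nat.cast_sub this, sub_sub_cancel]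

theorem prod_inv_columnWeight_le (N : ℕ) :
    ∏ i ∈ columns N, (columnWeight N i)⁻¹ ≤ Real.exp (4 * N) := by
  calc ∏ i ∈ columns N, (columnWeight N i)⁻¹
      = ∏ i ∈ columns N, (2 * N : ℝ) / (N - (i.natAbs : ℝ)) :=
        Finset.prod_congr rfl fun i _ => by
          rw [columnWeight, inv_div, Nat.cast_natAbs, Int.cast_abs]
    _ ≤ (∏ k ∈ Finset.range N, (2 * N : ℝ) / (N - k)) ^ 2 := by
        refine prod_columns_natAbs_le (f := fun k : ℕ => (2 * N : ℝ) / (N - k)) fun k hk => ?_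
        have hk' : (k : ℝ) < N := by exact_mod_cast hk
        rw [le_div_iff₀ (by linarith)]
        linarith [Nat.cast_nonneg (α := ℝ) k]
    _ ≤ Real.exp (2 * N) ^ 2 := by
        rw [prod_range_div_sub]
        gcongr
        exact Real.pow_div_factorial_le_exp _ (by positivity) N
    _ = Real.exp (4 * N) := by
        rw [← Real.exp_nat_mul]
        ring_nf

theorem tsum_prod_fin_ennreal {α : Type*} {n : ℕ} (f : Fin n → α → ENNReal) :
    ∑' x : Fin n → α, ∏ i, f i (x i) = ∏ i, ∑' y, f i y := by
  induction n with
  | zero => simp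
  | succ n ih =>
    rw [← (Fin.consEquiv fun _ => α).tsum_eq, Fin.prod_univ_succ]
    simp only [Fin.prod_univ_succ, Fin.consEquiv, Equiv.coe_fn_mk, Fin.cons_zero, Fin.cons_succ]
    rw [ENNReal.tsum_prod (f := fun y (x : Fin n → α) => f 0 y * ∏ i : Fin n, f i.succ (x i))]
    simp only [ENNReal.tsum_mul_left]
    rw [ENNReal.tsum_mul_right, ih]

theorem tsum_prod_ennreal {ι α : Type*} [Fintype ι] (f : ι → α → ENNReal) :
    ∑' x : ι → α, ∏ i, f i (x i) = ∏ i, ∑' y, f i y := by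
  have e := Fintype.equivFin ι
  rw [← (e.symm.arrowCongr (Equiv.refl α)).tsum_eq, ← e.symm.prod_comp, ← tsum_prod_fin_ennreal]
  refine tsum_congr fun x => ?_
  rw [← e.symm.prod_comp]
  simp [Equiv.arrowCongr]

/-- The Boltzmann factor, at inverse temperature `β`, of a step of a discrete path: the triple of
its curvature budget, second difference and mark, which has to obey the admissibility
constraints with `b` in place of `2 * A + 2`. -/
noncomputable def stepWeight (b : ℕ) (β : ℝ) (x : ℕ × ℤ × ℤ) : ENNReal :=
  if |x.2.1| ≤ (x.1 : ℤ) + 2 ∧ |x.2.2| ≤ b * ((x.1 : ℤ) + 1) then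
    ENNReal.ofReal (Real.exp (-(β * x.1))) else 0

theorem tsum_stepWeight_fiber_le {b : ℕ} (hb : 1 ≤ b) (β : ℝ) (n : ℕ) :
    ∑' y : ℤ × ℤ, stepWeight b β (n, y) ≤
      ENNReal.ofReal (30 * b * (((n + 2).choose 2 : ℕ) * Real.exp (-β) ^ n)) := by
  set s : Finset (ℤ × ℤ) := Finset.Icc (-((n : ℤ) + 2)) (n + 2) ×ˢ
    Finset.Icc (-(b * ((n : ℤ) + 1))) (b * (n + 1)) with hs
  have hmem : ∀ y, stepWeight b β (n, y) ≠ 0 → y ∈ s := fun y hy => by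
    have hadm : |y.1| ≤ (n : ℤ) + 2 ∧ |y.2| ≤ b * ((n : ℤ) + 1) := by
      by_contra h
      exact hy (if_neg h)
    rw [hs, Finset.mem_product, Finset.mem_Icc, Finset.mem_Icc]
    exact ⟨abs_le.1 hadm.1, abs_le.1 hadm.2⟩
  have hle : ∀ y, stepWeight b β (n, y) ≤ ENNReal.ofReal (Real.exp (-β) ^ n) := fun y => by
    rw [stepWeight, ← Real.exp_nat_mul, mul_neg, mul_comm (n : ℝ)]
    split_ifs
    exacts [le_refl (ENNReal.ofReal _), bot_le]
  have hcard : (s.card : ℝ) ≤ 30 * b * ((n + 2).choose 2 : ℕ) := by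
    have hcard : s.card = (2 * n + 5) * (2 * (b * (n + 1)) + 1) := by
      have hb' : (b : ℤ) * ((n : ℤ) + 1) = ((b * (n + 1) : ℕ) : ℤ) := by push_cast; ring
      rw [hs, Finset.card_product, Int.card_Icc, Int.card_Icc, hb']
      congr 1 <;> omega
    have hb1 : (1 : ℝ) ≤ b := by exact_mod_cast hb
    have : (0 : ℝ) ≤ n := n.cast_nonneg
    rw [hcard, Nat.cast_choose_two]
    push_cast
    calc (2 * (n : ℝ) + 5) * (2 * (b * (n + 1)) + 1)
        ≤ (5 * (n + 2)) * (3 * (b * (n + 1))) := by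
          gcongr <;> nlinarith
      _ = 30 * b * ((n + 2) * (n + 2 - 1) / 2) := by ring
  calc ∑' y : ℤ × ℤ, stepWeight b β (n, y) = ∑ y ∈ s, stepWeight b β (n, y) :=
        tsum_eq_sum fun y hy => not_not.1 fun h => hy (hmem y h)
    _ ≤ s.card • ENNReal.ofReal (Real.exp (-β) ^ n) :=
        Finset.sum_le_card_nsmul s _ _ fun y _ => hle y
    _ ≤ ENNReal.ofReal (30 * b * (((n + 2).choose 2 : ℕ) * Real.exp (-β) ^ n)) := by
        rw [nsmul_eq_mul, ← ENNReal.ofReal_natCast, ← ENNReal.ofReal_mul (Nat.cast_nonneg _),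
          ← mul_assoc]
        gcongr

theorem inv_one_sub_exp_neg_le {β : ℝ} (hβ : 0 < β) :
    1 / (1 - Real.exp (-β)) ≤ (1 + β) / β := by
  have hexp : Real.exp (-β) ≤ 1 / (1 + β) := by
    rw [Real.exp_neg, inv_eq_one_div]
    exact one_div_le_one_div_of_le (by linarith) (by linarith [Real.add_one_le_exp β])
  rw [← one_div_div β]
  refine one_div_le_one_div_of_le (by positivity) ?_
  calc β / (1 + β) = 1 - 1 / (1 + β) := by field_simp; ring
    _ ≤ 1 - Real.exp (-β) := sub_le_sub_left hexp 1

theorem tsum_stepWeight_le {b : ℕ} (hb : 1 ≤ b) {β : ℝ} (hβ : 0 < β) :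
    ∑' x, stepWeight b β x ≤ ENNReal.ofReal (30 * b * ((1 + β) / β) ^ 3) := by
  have hlt : Real.exp (-β) < 1 := Real.exp_lt_one_iff.2 (neg_lt_zero.2 hβ)
  have hnorm : ‖Real.exp (-β)‖ < 1 := by rwa [Real.norm_of_nonneg (Real.exp_pos _).le]
  have hsum := (summable_choose_mul_geometric_of_norm_lt_one 2 hnorm).mul_left (30 * (b : ℝ))
  calc ∑' x, stepWeight b β x = ∑' (n : ℕ) (y : ℤ × ℤ), stepWeight b β (n, y) :=
        ENNReal.tsum_prod (f := fun n y => stepWeight b β (n, y))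
    _ ≤ ∑' n : ℕ, ENNReal.ofReal (30 * b * (((n + 2).choose 2 : ℕ) * Real.exp (-β) ^ n)) :=
        ENNReal.tsum_le_tsum (tsum_stepWeight_fiber_le hb β)
    _ = ENNReal.ofReal (30 * b * (1 / (1 - Real.exp (-β))) ^ 3) := by
        rw [← ENNReal.ofReal_tsum_of_nonneg (fun n => by positivity) hsum, tsum_mul_left,
          tsum_choose_mul_geometric_of_norm_lt_one 2 hnorm, one_div_pow]
    _ ≤ ENNReal.ofReal (30 * b * ((1 + β) / β) ^ 3) :=
        ENNReal.ofReal_le_ofReal (mul_le_mul_of_nonneg_left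
          (pow_le_pow_left₀ (one_div_nonneg.2 (sub_pos.2 hlt).le) (inv_one_sub_exp_neg_le hβ) 3)
          (by positivity))

/-- A bound for the entropy per column of the discrete paths, at inverse temperature `γ`. -/
noncomputable def stepEntropy (b : ℕ) (γ : ℝ) : ℝ := Real.log (30 * b * ((1 + γ) / γ) ^ 3)

theorem tsum_stepWeight_columnWeight_le {b : ℕ} (hb : 1 ≤ b) {γ : ℝ} (hγ : 0 < γ) {N : ℕ} {i : ℤ}
    (hi : i ∈ columns N) :
    ∑' x, stepWeight b (γ * columnWeight N i) x ≤
      ENNReal.ofReal (Real.exp (stepEntropy b γ) * (columnWeight N i)⁻¹ ^ 3) := by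
  have hpos := columnWeight_pos hi
  have : (0 : ℝ) < b := by exact_mod_cast hb
  refine (tsum_stepWeight_le hb (mul_pos hγ hpos)).trans (ENNReal.ofReal_le_ofReal ?_)
  rw [stepEntropy, Real.exp_log (by positivity), mul_assoc _ (_ ^ 3) (_ ^ 3), ← mul_pow,
    ← div_eq_mul_inv, div_div]
  have hle : γ * columnWeight N i ≤ γ :=
    mul_le_of_le_one_right hγ.le ((columnWeight_le N i).trans (by norm_num))
  gcongr

theorem stepEntropy_nonneg {b : ℕ} (hb : 1 ≤ b) {γ : ℝ} (hγ : 0 < γ) : 0 ≤ stepEntropy b γ := by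
  have hb' : (1 : ℝ) ≤ b := by exact_mod_cast hb
  have hγ' : 1 ≤ ((1 + γ) / γ) ^ 3 := one_le_pow₀ ((one_le_div hγ).2 (by linarith))
  exact Real.log_nonneg (one_le_mul_of_one_le_of_one_le (by linarith) hγ')

theorem tsum_prod_stepWeight_le {b : ℕ} (hb : 1 ≤ b) {γ : ℝ} (hγ : 0 < γ) (N : ℕ) :
    ∑' x : columns N → ℕ × ℤ × ℤ, ∏ i : columns N, stepWeight b (γ * columnWeight N i) (x i) ≤
      ENNReal.ofReal (Real.exp ((12 + 2 * stepEntropy b γ) * N)) := by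
  have hcard : ((columns N).card : ℝ) ≤ 2 * N := by exact_mod_cast card_columns_le N
  have hinv : ∀ i ∈ columns N, 0 ≤ (columnWeight N i)⁻¹ := fun i hi =>
    inv_nonneg.2 (columnWeight_pos hi).le
  calc ∑' x : columns N → ℕ × ℤ × ℤ, ∏ i : columns N, stepWeight b (γ * columnWeight N i) (x i)
      = ∏ i : columns N, ∑' y, stepWeight b (γ * columnWeight N i) y := tsum_prod_ennreal _
    _ = ∏ i ∈ columns N, ∑' y, stepWeight b (γ * columnWeight N i) y :=
        Finset.prod_coe_sort (columns N) fun i => ∑' y, stepWeight b (γ * columnWeight N i) y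
    _ ≤ ∏ i ∈ columns N,
          ENNReal.ofReal (Real.exp (stepEntropy b γ) * (columnWeight N i)⁻¹ ^ 3) :=
        Finset.prod_le_prod' fun i hi => tsum_stepWeight_columnWeight_le hb hγ hi
    _ = ENNReal.ofReal (Real.exp (stepEntropy b γ) ^ (columns N).card *
          (∏ i ∈ columns N, (columnWeight N i)⁻¹) ^ 3) := by
        rw [← ENNReal.ofReal_prod_of_nonneg fun i hi =>
          mul_nonneg (Real.exp_pos _).le (pow_nonneg (hinv i hi) 3),
          Finset.prod_mul_distrib, Finset.prod_const, Finset.prod_pow]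
    _ ≤ ENNReal.ofReal (Real.exp (2 * N * stepEntropy b γ) * Real.exp (4 * N) ^ 3) := by
        rw [← Real.exp_nat_mul]
        have := stepEntropy_nonneg hb hγ
        have := Finset.prod_nonneg hinv
        have := prod_inv_columnWeight_le N
        gcongr
    _ = ENNReal.ofReal (Real.exp ((12 + 2 * stepEntropy b γ) * N)) := by
        rw [← Real.exp_nat_mul, ← Real.exp_add]
        push_cast
        ring_nf

namespace DiscretePath

variable {N : ℕ}

/-- The data which determine a discrete path column by column. -/
def step (ξ : DiscretePath N) (i : columns N) : ℕ × ℤ × ℤ :=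
  (ξ.curv i, ξ.secondDifference i, ξ.mark i)

theorem step_injective : Function.Injective (step (N := N)) := fun ξ ξ' h => by
  have hstep : ∀ i, ξ.step i = ξ'.step i := congrFun h
  simp only [step, Prod.mk.injEq] at hstep
  have hheight : ξ.height = ξ'.height := funext fun i => sub_eq_zero.1 <|
    eq_zero_of_second_difference_eq_zero (N := N) (G := fun i => ξ.height i - ξ'.height i)
      (fun i hi => by rw [ξ.height_eq_zero i hi, ξ'.height_eq_zero i hi, sub_self])
      (fun i hi => by
        have := (hstep ⟨i, hi⟩).2.1
        simp only [secondDifference] at this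
        linarith) i
  obtain ⟨height, curv, mark, _⟩ := ξ
  obtain ⟨height', curv', mark', _⟩ := ξ'
  obtain rfl : height = height' := hheight
  obtain rfl : curv = curv' := funext fun i => (hstep i).1
  obtain rfl : mark = mark' := funext fun i => (hstep i).2.2
  rfl

instance : Countable (DiscretePath N) := step_injective.countable

theorem prod_stepWeight_step {ξ : DiscretePath N} {A : ℕ} (h : ξ.IsAdmissible A) (γ : ℝ) :
    ∏ i : columns N, stepWeight (2 * A + 2) (γ * columnWeight N i) (ξ.step i) =
      ENNReal.ofReal (Real.exp (-(γ * ξ.energy))) := by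
  rw [energy, Finset.mul_sum, ← Finset.sum_neg_distrib, Real.exp_sum,
    ENNReal.ofReal_prod_of_nonneg fun i _ => (Real.exp_pos _).le]
  refine Finset.prod_congr rfl fun i _ => ?_
  rw [stepWeight, if_pos ⟨h.abs_secondDifference_le i, by exact_mod_cast h.abs_mark_le i⟩,
    mul_assoc]
  rfl

section Overcharge

variable {Ω : Type*} {l : ℤ × ℤ → Ω → ℝ}

/-- The event that the obstacles charged to some admissible discrete path are strong enough to pay
for its energy and for `B`, when a unit of charge buys `c` units of energy. -/
def overchargeEvent (l : ℤ × ℤ → Ω → ℝ) (A N : ℕ) (c B : ℝ) : Set Ω :=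
  ⋃ ξ : DiscretePath N,
    {ω | ξ.IsAdmissible A ∧ ξ.energy + B ≤ c * ξ.charge A fun p => l p ω}

variable [MeasurableSpace Ω] {P : Measure Ω} {lam c : ℝ} {A : ℕ}

theorem measurableSet_overchargeEvent (hl : ∀ p, Measurable (l p)) (A N : ℕ) (c B : ℝ) :
    MeasurableSet (overchargeEvent l A N c B) :=
  MeasurableSet.iUnion fun ξ => (MeasurableSet.const _).inter
    (measurableSet_le measurable_const ((ξ.measurable_charge hl A).const_mul c))

theorem measure_charge_ge_energy_le (hlam : 0 < lam) (h : IsIIDExponential P lam l) (hA : 1 ≤ A)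
    (hc : 0 < c) (B : ℝ) (ξ : DiscretePath N) :
    P {ω | ξ.IsAdmissible A ∧ ξ.energy + B ≤ c * ξ.charge A fun p => l p ω} ≤
      ENNReal.ofReal (Real.exp (18 * N - lam / (8 * c) * B)) *
        ∏ i : columns N, stepWeight (2 * A + 2) (lam / (8 * c) * columnWeight N i) (ξ.step i) := by
  have := h.indep.isProbabilityMeasure
  by_cases hξ : ξ.IsAdmissible A
  · simp only [hξ, true_and, prod_stepWeight_step hξ]
    rw [← ENNReal.ofReal_mul (Real.exp_pos _).le, ← Real.exp_add, ← ofReal_measureReal]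
    refine ENNReal.ofReal_le_ofReal ?_
    have htail := ξ.measureReal_charge_ge_le hlam h hA ((ξ.energy + B) / c)
    simp only [div_le_iff₀' hc] at htail
    refine htail.trans_eq (congrArg _ ?_)
    field_simp
    ring
  · simp [hξ]

theorem measureReal_overchargeEvent_le (hlam : 0 < lam) (h : IsIIDExponential P lam l)
    (hA : 1 ≤ A) (hc : 0 < c) (N : ℕ) (B : ℝ) :
    P.real (overchargeEvent l A N c B) ≤
      Real.exp ((30 + 2 * stepEntropy (2 * A + 2) (lam / (8 * c))) * N - lam / (8 * c) * B) := by
  set γ := lam / (8 * c)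
  have hγ0 : 0 < γ := by positivity
  refine ENNReal.toReal_le_of_le_ofReal (Real.exp_pos _).le ?_
  calc P (overchargeEvent l A N c B)
      ≤ ∑' ξ : DiscretePath N,
          P {ω | ξ.IsAdmissible A ∧ ξ.energy + B ≤ c * ξ.charge A fun p => l p ω} :=
        measure_iUnion_le _
    _ ≤ ∑' ξ : DiscretePath N, ENNReal.ofReal (Real.exp (18 * N - γ * B)) *
          ∏ i : columns N, stepWeight (2 * A + 2) (γ * columnWeight N i) (ξ.step i) :=
        ENNReal.tsum_le_tsum (measure_charge_ge_energy_le hlam h hA hc B)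
    _ ≤ ENNReal.ofReal (Real.exp (18 * N - γ * B)) * ∑' x : columns N → ℕ × ℤ × ℤ,
          ∏ i : columns N, stepWeight (2 * A + 2) (γ * columnWeight N i) (x i) := by
        rw [ENNReal.tsum_mul_left]
        gcongr
        exact ENNReal.tsum_comp_le_tsum_of_injective step_injective
          fun x => ∏ i : columns N, stepWeight (2 * A + 2) (γ * columnWeight N i) (x i)
    _ ≤ ENNReal.ofReal (Real.exp (18 * N - γ * B)) *
          ENNReal.ofReal (Real.exp ((12 + 2 * stepEntropy (2 * A + 2) γ) * N)) := by
        gcongr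
        exact tsum_prod_stepWeight_le (by omega) hγ0 N
    _ = ENNReal.ofReal (Real.exp ((30 + 2 * stepEntropy (2 * A + 2) γ) * N - γ * B)) := by
        rw [← ENNReal.ofReal_mul (Real.exp_pos _).le, ← Real.exp_add]
        ring_nf

end Overcharge

end DiscretePath

theorem IsDirichletSolution.cone_le_of_notMem_overchargeEvent {Ω : Type*} {ω : Ω}
    {l : ℤ × ℤ → Ω → ℝ} {φ g : ℝ × ℝ → ℝ} {u : ℝ → ℝ} {δ K M F₀ F : ℝ} {A N : ℕ}
    (hδ0 : 0 ≤ δ) (hδ : δ < 1 / 2) (hN : 1 ≤ N) (hA : 2 * (1 + 4 / (1 - 2 * δ)) ≤ A)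
    (hφ : Continuous φ) (hφ0 : ∀ z, 0 ≤ φ z) (hsupp : Function.support φ ⊆ obstacleSquare δ)
    (hM0 : 0 ≤ M) (hM : ∀ z, φ z ≤ M) (hl : ∀ p, 0 ≤ l p ω) (hg : Continuous g)
    (hg0 : ∀ z, 0 ≤ g z) (hF₀ : 0 ≤ F₀) (hF : F₀ ≤ F) (hK : 0 ≤ K)
    (hu : IsDirichletSolution (obstacleField φ g fun p => l p ω) F (-(N - δ)) (N - δ) u)
    (hω : ω ∉ DiscretePath.overchargeEvent l A N (6 * M) ((F₀ - (10 * K + 1)) * N)) {x : ℝ}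
    (hx : x ∈ Icc (-(N - δ)) (N - δ)) : K * (N - δ - |x|) ≤ u x := by
  by_contra! hdip
  obtain ⟨ξ, hξ, hcharge⟩ := hu.exists_charged_discretePath hδ0 hδ hN hA hφ hφ0 hsupp hM0 hM hl hg
    hg0 (hF₀.trans hF) hK hx hdip
  refine hω (mem_iUnion.2 ⟨ξ, hξ, ?_⟩)
  calc ξ.energy + (F₀ - (10 * K + 1)) * N ≤ ξ.energy + (F - (10 * K + 1)) * N := by gcongr
    _ ≤ 6 * M * ξ.charge A fun p => l p ω := hcharge.trans_eq (mul_assoc _ _ _).symm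

theorem theorem2p1_general {δ lam K c : ℝ} {φ : ℝ × ℝ → ℝ} (hδ0 : 0 ≤ δ) (hδ : δ < 1 / 2)
    (hlam : 0 < lam) (hφ : Continuous φ) (hφ0 : ∀ z, 0 ≤ φ z)
    (hsupp : Function.support φ ⊆ obstacleSquare δ) (hK : 0 ≤ K) (hc : 0 ≤ c) :
    ∃ F₀ > (0 : ℝ), ∀ (Ω : Type*) [MeasurableSpace Ω] (P : Measure Ω) (l : ℤ × ℤ → Ω → ℝ),
      IsIIDExponential P lam l → ∀ N : ℕ, 1 ≤ N →
        ∃ E : Set Ω, MeasurableSet E ∧ 1 - Real.exp (-(c * N)) ≤ P.real E ∧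
          ∀ ω ∈ E, ∀ g : ℝ × ℝ → ℝ, Continuous g → (∀ z, 0 ≤ g z) → ∀ F : ℝ, F₀ ≤ F →
            ∀ u : ℝ → ℝ,
              IsDirichletSolution (obstacleField φ g fun p => l p ω) F (-(N - δ)) (N - δ) u →
              ∀ x ∈ Icc (-(N - δ)) (N - δ), K * (N - δ - |x|) ≤ u x := by
  obtain ⟨M, hM1, hM⟩ := exists_forall_le_of_support_subset_obstacleSquare hφ hsupp
  obtain ⟨A, hA⟩ := exists_nat_ge (2 * (1 + 4 / (1 - 2 * δ)))
  have hA1 : 1 ≤ A := by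
    have : 0 ≤ 4 / (1 - 2 * δ) := div_nonneg (by norm_num) (by linarith)
    exact_mod_cast (show (1 : ℝ) ≤ A by linarith)
  have hM0 : 0 < M := by linarith
  set γ := lam / (8 * (6 * M)) with hγ
  have hγ0 : 0 < γ := by positivity
  set h := 30 + 2 * stepEntropy (2 * A + 2) γ with hh
  have hh0 : 0 ≤ h := by linarith [stepEntropy_nonneg (b := 2 * A + 2) (by omega) hγ0]
  have hF₀ : 0 < 10 * K + 1 + (h + c) / γ := by positivity
  refine ⟨_, hF₀, fun Ω _ P l hl N hN => ?_⟩
  have := hl.indep.isProbabilityMeasure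
  set bad := DiscretePath.overchargeEvent l A N (6 * M)
    ((10 * K + 1 + (h + c) / γ - (10 * K + 1)) * N)
  have hbad : P.real bad ≤ Real.exp (-(c * N)) :=
    (DiscretePath.measureReal_overchargeEvent_le hlam hl hA1 (by positivity) N _).trans_eq
      (by rw [← hγ, ← hh]; congr 1; field_simp; ring)
  have hmeas : MeasurableSet bad := DiscretePath.measurableSet_overchargeEvent hl.measurable _ _ _ _
  refine ⟨{ω | ∀ p, 0 < l p ω} ∩ badᶜ, ?_, ?_, fun ω hω g hg hg0 F hF u hu x hx =>
    hu.cone_le_of_notMem_overchargeEvent hδ0 hδ hN hA hφ hφ0 hsupp hM0.le hM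
      (fun p => (hω.1 p).le) hg hg0 hF₀.le hF hK hω.2 hx⟩
  · exact (measurableSet_setOfPred.2 (Measurable.forall fun p =>
      measurableSet_setOfPred.1 (measurableSet_lt measurable_const (hl.measurable p)))).inter
      hmeas.compl
  · rw [measureReal_congr (inter_ae_eq_right_of_ae_eq_univ
      (eventuallyEq_univ.2 hl.ae_pos)), probReal_compl_eq_one_sub hmeas]
    exact sub_le_sub_left hbad 1

theorem theorem2p1 (δ : ℝ) (hδ : 0 < δ) (hδ' : δ < 1 / 2) (lam : ℝ) (hlam : 0 < lam)
    (φ : ℝ × ℝ → ℝ) (hφ : IsObstacleProfile δ φ) :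
    ∃ F₀ > (0 : ℝ), ∃ C > (0 : ℝ), ∃ K > (0 : ℝ), ∃ N₀ : ℕ,
      ∀ (Ω : Type*) [MeasurableSpace Ω] (P : Measure Ω) [IsProbabilityMeasure P]
        (l : ℤ × ℤ → Ω → ℝ) (g : Ω → ℝ × ℝ → ℝ),
        IsIIDExponential P lam l → IsCompensator P φ l g →
        ∀ F : ℝ, F₀ < F → ∀ N : ℕ, N₀ ≤ N →
          ∃ E : Set Ω, MeasurableSet E ∧ 1 - C * Real.exp (-((N : ℝ) / C)) ≤ P.real E ∧
            ∀ ω ∈ E, ∀ u : ℝ → ℝ,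
              IsDirichletSolution (obstacleField φ (g ω) (fun p => l p ω)) F
                (-(N : ℝ) + δ) ((N : ℝ) - δ) u →
              ∀ x ∈ Icc (-(N : ℝ) + δ) ((N : ℝ) - δ),
                max (K * ((N : ℝ) - 1) - K * |x|) 0 ≤ u x := by
  obtain ⟨F₀, hF₀, h⟩ := theorem2p1_general hδ.le hδ' hlam hφ.smooth.continuous hφ.nonneg
    hφ.support_subset zero_le_one zero_le_one
  refine ⟨F₀, hF₀, 1, one_pos, 1, one_pos, 1, fun Ω _ P _ l g hl hg F hF N hN => ?_⟩
  obtain ⟨E, hE, hPE, hcone⟩ := h Ω P l hl N hN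
  refine ⟨E, hE, by simpa only [one_mul, div_one] using hPE, fun ω hω u hu x hx => ?_⟩
  rw [neg_add_eq_sub, ← neg_sub] at hu hx
  have hux := hcone ω hω (g ω) (hg.contDiff ω).continuous (hg.nonneg ω) F hF.le u hu x hx
  exact max_le (by linarith) (by linarith [abs_le.2 hx])
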